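/- **Mobile Ambients.** Fix an infinite set of names $n,m,\dots$ and an infinite set of variables $x,y,\dots$; $\eta$ ranges over both. Capabilities are $\mathsf{cap}::=\mathsf{in}\,\eta\mid\mathsf{out}\,\eta\mid\mathsf{open}\,\eta$, and processes are $$P::=\mathbf 0\mid P|P\mid\,!P\mid\mathsf{cap}.P\mid\eta[P]\mid\langle\eta\rangle\mid(x)P,$$ up to $\alpha$-conversion ($x$ is bound in $(x)P$); $\mathrm{fn}(P)$ is the set of names of $P$. Structural congruence $\equiv$ is the smallest congruence with $P|\mathbf 0\equiv P$, $P|Q\equiv Q|P$, $P|(Q|R)\equiv(P|Q)|R$, $!P\equiv{!P}|P$, $!\mathbf 0\equiv\mathbf 0$, $!(P|Q)\equiv{!P}|{!Q}$, $!!P\equiv{!P}$. Reduction $\to$ on closed processes is the smallest relation containing $\mathsf{open}\,n.P|n[Q]\to P|Q$; $n[\mathsf{in}\,m.P_1|P_2]\,|\,m[Q]\to m[n[P_1|P_2]|Q]$; $m[n[\mathsf{out}\,m.P_1|P_2]|Q]\to n[P_1|P_2]\,|\,m[Q]$; $\langle n\rangle|(x)P\to P\{n/x\}$, and closed under $-|Q$,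 $n[-]$ and $\equiv$; $\Rightarrow$ is its reflexive transitive closure. **Transitions (on closed processes).** $P\xrightarrow{\mathsf{cap}}P'$ if $P\equiv\mathsf{cap}.P_1|P_2$ and $P'=P_1|P_2$ for some $P_1,P_2$; $P\xrightarrow{\langle n\rangle}P'$ if $P\equiv\langle n\rangle|P'$; $P\xrightarrow{?n}P'$ if $P\equiv(x)P_1|P_2$ and $P'\equiv P_1\{n/x\}|P_2$ for some $P_1,P_2$; $\stackrel{\mu}{\Rightarrow}$ is $\Rightarrow\xrightarrow{\mu}\Rightarrow$. Let $\mathrm{St}(M_1,M_2)$ be the reflexive transitive closure of $\stackrel{M_1}{\Rightarrow}\stackrel{M_2}{\Rightarrow}$. Define $\Rrightarrow_{\mathsf{in}\,n}$ as $\Rightarrow\mathrm{St}(\mathsf{out}\,n,\mathsf{in}\,n)$, $\Rrightarrow_{\mathsf{out}\,n}$ as $\Rightarrow\mathrm{St}(\mathsf{in}\,n,\mathsf{out}\,n)$, and $\Rrightarrow_{\mathsf{open}\,n}$ as $\Rightarrow$ (juxtaposition is composition of relations, from left to right). **Intensional bisimilarity** $\simeq_{\mathrm{int}}$ is the largest symmetric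 relation $\mathcal R$ on closed processes such that $P\mathcal RQ$ implies: (1) if $P\equiv P_1|P_2$ then $Q\equiv Q_1|Q_2$ for some $Q_i$ with $P_i\mathcal RQ_i$; (2) if $P\equiv\mathbf 0$ then $Q\equiv\mathbf 0$; (3) if $P\to P'$ then $Q\Rightarrow Q'$ for some $Q'$ with $P'\mathcal RQ'$; (4) if $P\xrightarrow{\mathsf{in}\,n}P'$ then $Q\stackrel{\mathsf{in}\,n}{\Rightarrow}\mathrm{St}(\mathsf{out}\,n,\mathsf{in}\,n)\,Q'$ for some $Q'$ with $P'\mathcal RQ'$; (5) if $P\xrightarrow{\mathsf{out}\,n}P'$ then $Q\stackrel{\mathsf{out}\,n}{\Rightarrow}\mathrm{St}(\mathsf{in}\,n,\mathsf{out}\,n)\,Q'$ for some $Q'$ with $P'\mathcal RQ'$; (6) if $P\xrightarrow{\mathsf{open}\,n}P'$ then $Q\stackrel{\mathsf{open}\,n}{\Rightarrow}Q'$ for some $Q'$ with $P'\mathcal RQ'$; (7) if $P\xrightarrow{\langle n\rangle}P'$ then $Q\stackrel{\langle n\rangle}{\Rightarrow}Q'$ for some $Q'$ with $P'\mathcal RQ'$;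 (8) if $P\xrightarrow{?n}P'$ then $Q|\langle n\rangle\Rightarrow Q'$ for some $Q'$ with $P'\mathcal RQ'$; (9) if $P\equiv n[P']$ then $Q\equiv n[Q']$ for some $Q'$ with $P'\mathcal RQ'$. **Order.** The eta law, applied from left to right to one subterm and modulo $\equiv$, rewrites $(x)((x)P|\langle x\rangle)$ to $(x)P$; a normal form reached by such rewriting is an eta normal form. The sequentiality degree is $\mathsf{sd}(\mathbf 0)=0$, $\mathsf{sd}(P|Q)=\max(\mathsf{sd}P,\mathsf{sd}Q)$, $\mathsf{sd}(\eta[P])=\mathsf{sd}(!P)=\mathsf{sd}(P)$, $\mathsf{sd}(\mathsf{cap}.P)=1+\mathsf{sd}(P)$, $\mathsf{sd}(\langle\eta\rangle)=1$, $\mathsf{sd}((x)P)=1+\mathsf{sd}(P')$ where $(x)P'$ is the eta normal form of $(x)P$. For possibly open processes put $P<Q$ if $\mathsf{sd}(P)<\mathsf{sd}(Q)$ or $P$ is a strict subterm of $Q$. **The relation $\sim_{\mathrm{ind}}$** on closed processes is defined recursively, by cases on the left-hand process: 1. $\mathbf 0\sim_{\mathrm{ind}}Q$ iff $Q\equiv\mathbf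 0$; 2. $n[P]\sim_{\mathrm{ind}}Q$ iff there is $Q'$ with $Q\equiv n[Q']$ and $P\sim_{\mathrm{ind}}Q'$; 3. $P_1|P_2\sim_{\mathrm{ind}}Q$ iff there are $Q_1,Q_2$ with $Q\equiv Q_1|Q_2$ and $P_i\sim_{\mathrm{ind}}Q_i$ for $i=1,2$; 4. $!P\sim_{\mathrm{ind}}Q$ iff there are $r\ge1$, $s\ge r$ and $Q_1,\dots,Q_s$ with $Q\equiv\prod_{i\le r}!Q_i\,|\,\prod_{r<i\le s}Q_i$ and $P\sim_{\mathrm{ind}}Q_i$ for all $i$; 5. $\mathsf{cap}.P\sim_{\mathrm{ind}}Q$ iff there is $Q'$ with $Q\equiv\mathsf{cap}.Q'$, $P\Rrightarrow_{\mathsf{cap}}\sim_{\mathrm{ind}}Q'$ and $Q'\Rrightarrow_{\mathsf{cap}}\sim_{\mathrm{ind}}P$; 6. $\langle n\rangle\sim_{\mathrm{ind}}Q$ iff $Q\equiv\langle n\rangle$; 7. $(x)P\sim_{\mathrm{ind}}Q$ iff there are $Q'$ and $m\notin\mathrm{fn}(P)\cup\mathrm{fn}(Q)$ with $Q\equiv(x)Q'$,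 $Q|\langle m\rangle\Rightarrow\sim_{\mathrm{ind}}P\{m/x\}$ and $(x)P|\langle m\rangle\Rightarrow\sim_{\mathrm{ind}}Q'\{m/x\}$. **Theorem.** The order $<$ is well-founded, and $\sim_{\mathrm{ind}}$ is well defined: the recursion is well-founded (there is a well-founded relation on pairs of closed processes such that the right-hand side of the clause for $(P,Q)$ depends on the values of $\sim_{\mathrm{ind}}$ at smaller pairs only), and there is exactly one relation on closed processes that satisfies clauses 1–7. Moreover, $\sim_{\mathrm{ind}}$ and $\simeq_{\mathrm{int}}$ coincide. -/

import Mathlib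

universe u

namespace MA

/-! ### Syntax of (public) Mobile Ambients

Processes are taken up to alpha-conversion by using well-scoped de Bruijn indices: `Proc N k` is the
type of processes over the set of names `N` whose free variables are among `k` given variables.
Closed processes are the elements of `Proc N 0`. -/

/-- Identifiers `η`: a name, or one of the `k` variables in scope.  Those of `Id N 0` are exactly
the names. -/
abbrev Id (N : Type u) (k : ℕ) : Type u := N ⊕ Fin k

/-- Capabilities `in η`, `out η`, `open η`. -/
inductive Cap (V : Type u) : Type u
  | enter (η : V) : Cap V
  | exit (η : V) : Cap V
  | dissolve (η : V) : Cap V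

/-- Renaming in a capability. -/
def Cap.map {V W : Type u} (f : V → W) : Cap V → Cap W
  | .enter η => .enter (f η)
  | .exit η => .exit (f η)
  | .dissolve η => .dissolve (f η)

/-- The identifier which a capability is about. -/
def Cap.id {V : Type u} : Cap V → V
  | .enter η => η
  | .exit η => η
  | .dissolve η => η

/-- Processes: `0`, `P | Q`, `!P`, `cap.P`, `η[P]`, `⟨η⟩`, `(x)P`.
In `abs P` the bound variable is the variable `0` of `P`. -/
inductive Proc (N : Type u) : ℕ → Type u
  | nil {k : ℕ} : Proc N k
  | par {k : ℕ} (P Q : Proc N k) : Proc N k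
  | repl {k : ℕ} (P : Proc N k) : Proc N k
  | pre {k : ℕ} (c : Cap (Id N k)) (P : Proc N k) : Proc N k
  | amb {k : ℕ} (η : Id N k) (P : Proc N k) : Proc N k
  | msg {k : ℕ} (η : Id N k) : Proc N k
  | abs {k : ℕ} (P : Proc N (k + 1)) : Proc N k

variable {N : Type u}

/-- Weakening of identifiers: every variable `i` becomes `i + 1`. -/
def Id.shift {k : ℕ} : Id N k → Id N (k + 1) :=
  Sum.map (fun n => n) Fin.succ

/-- Extension of a map of identifiers under a binder. -/
def Id.lift {k l : ℕ} (f : Id N k → Id N l) : Id N (k + 1) → Id N (l + 1) :=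
  Sum.elim (fun n => Id.shift (f (Sum.inl n)))
    (Fin.cases (Sum.inr 0) (fun i => Id.shift (f (Sum.inr i))))

/-- Capture-avoiding simultaneous replacement of identifiers. -/
def Proc.rename : {k l : ℕ} → (Id N k → Id N l) → Proc N k → Proc N l
  | _, _, _, .nil => .nil
  | _, _, f, .par P Q => .par (P.rename f) (Q.rename f)
  | _, _, f, .repl P => .repl (P.rename f)
  | _, _, f, .pre c P => .pre (c.map f) (P.rename f)
  | _, _, f, .amb η P => .amb (f η) (P.rename f)
  | _, _, f, .msg η => .msg (f η)
  | _, _, f, .abs P => .abs (P.rename (Id.lift f))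

/-- Weakening: `P` seen as a process with one more variable in scope, which is not free in it. -/
def Proc.weaken {k : ℕ} (P : Proc N k) : Proc N (k + 1) := P.rename Id.shift

/-- `P.inst η` is `P{η/x}`, where `x` is the variable `0` of `P`. -/
def Proc.inst {k : ℕ} (P : Proc N (k + 1)) (η : Id N k) : Proc N k :=
  P.rename (Sum.elim Sum.inl (Fin.cases η Sum.inr))

/-- The set of names of an identifier. -/
def Id.names {k : ℕ} : Id N k → Set N
  | .inl n => {n}
  | .inr _ => ∅

/-- The (free) names of a process. -/
def Proc.fn : {k : ℕ} → Proc N k → Set N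
  | _, .nil => ∅
  | _, .par P Q => P.fn ∪ Q.fn
  | _, .repl P => P.fn
  | _, .pre c P => Id.names c.id ∪ P.fn
  | _, .amb η P => Id.names η ∪ P.fn
  | _, .msg η => Id.names η
  | _, .abs P => P.fn

/-- `P₁ | ⋯ | Pₙ`. -/
def Proc.parList {k : ℕ} (L : List (Proc N k)) : Proc N k := L.foldr Proc.par Proc.nil

/-! ### Structural congruence and reduction -/

/-- Structural congruence `≡`. -/
inductive SC : {k : ℕ} → Proc N k → Proc N k → Prop
  | refl {k : ℕ} (P : Proc N k) : SC P P
  | symm {k : ℕ} {P Q : Proc N k} : SC P Q → SC Q P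
  | trans {k : ℕ} {P Q R : Proc N k} : SC P Q → SC Q R → SC P R
  | par {k : ℕ} {P P' Q Q' : Proc N k} : SC P P' → SC Q Q' → SC (.par P Q) (.par P' Q')
  | repl {k : ℕ} {P P' : Proc N k} : SC P P' → SC (.repl P) (.repl P')
  | pre {k : ℕ} (c : Cap (Id N k)) {P P' : Proc N k} : SC P P' → SC (.pre c P) (.pre c P')
  | amb {k : ℕ} (η : Id N k) {P P' : Proc N k} : SC P P' → SC (.amb η P) (.amb η P')
  | abs {k : ℕ} {P P' : Proc N (k + 1)} : SC P P' → SC (.abs P) (.abs P')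
  | parNil {k : ℕ} (P : Proc N k) : SC (.par P .nil) P
  | parComm {k : ℕ} (P Q : Proc N k) : SC (.par P Q) (.par Q P)
  | parAssoc {k : ℕ} (P Q R : Proc N k) : SC (.par P (.par Q R)) (.par (.par P Q) R)
  | replUnfold {k : ℕ} (P : Proc N k) : SC (.repl P) (.par (.repl P) P)
  | replNil {k : ℕ} : SC (.repl (.nil : Proc N k)) .nil
  | replPar {k : ℕ} (P Q : Proc N k) : SC (.repl (.par P Q)) (.par (.repl P) (.repl Q))
  | replRepl {k : ℕ} (P : Proc N k) : SC (.repl (.repl P)) (.repl P)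

/-- The reduction relation `⟶` on closed processes. -/
inductive Red : Proc N 0 → Proc N 0 → Prop
  | opening (n : Id N 0) (P Q : Proc N 0) :
      Red (.par (.pre (.dissolve n) P) (.amb n Q)) (.par P Q)
  | entering (n m : Id N 0) (P₁ P₂ Q : Proc N 0) :
      Red (.par (.amb n (.par (.pre (.enter m) P₁) P₂)) (.amb m Q))
        (.amb m (.par (.amb n (.par P₁ P₂)) Q))
  | exiting (n m : Id N 0) (P₁ P₂ Q : Proc N 0) :
      Red (.amb m (.par (.amb n (.par (.pre (.exit m) P₁) P₂)) Q))
        (.par (.amb n (.par P₁ P₂)) (.amb m Q))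
  | com (n : Id N 0) (P : Proc N 1) : Red (.par (.msg n) (.abs P)) (P.inst n)
  | par {P P' : Proc N 0} (Q : Proc N 0) : Red P P' → Red (.par P Q) (.par P' Q)
  | amb (n : Id N 0) {P P' : Proc N 0} : Red P P' → Red (.amb n P) (.amb n P')
  | str {P P' P'' P''' : Proc N 0} : SC P P' → Red P' P'' → SC P'' P''' → Red P P'''

/-- `⟹`, the reflexive and transitive closure of `⟶`. -/
def Reds : Proc N 0 → Proc N 0 → Prop := Relation.ReflTransGen Red

/-! ### Labelled transitions and stuttering -/

/-- `P —cap→ P'`. -/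
def CapStep (c : Cap (Id N 0)) (P P' : Proc N 0) : Prop :=
  ∃ P₁ P₂, SC P (.par (.pre c P₁) P₂) ∧ P' = .par P₁ P₂

/-- `P —⟨n⟩→ P'`. -/
def MsgStep (n : Id N 0) (P P' : Proc N 0) : Prop :=
  SC P (.par (.msg n) P')

/-- `P —?n→ P'`. -/
def InStep (n : Id N 0) (P P' : Proc N 0) : Prop :=
  ∃ (P₁ : Proc N 1) (P₂ : Proc N 0), SC P (.par (.abs P₁) P₂) ∧ SC P' (.par (P₁.inst n) P₂)

/-- The weak transition `⟹ —μ→ ⟹` associated with a transition `—μ→`. -/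
def Weak (step : Proc N 0 → Proc N 0 → Prop) (P P' : Proc N 0) : Prop :=
  ∃ A B, Reds P A ∧ step A B ∧ Reds B P'

/-- Stuttering: there are `i ≥ 1` and `P = P₁, …, Pᵢ = P'` such that each `Pᵣ₊₁` is reached from
`Pᵣ` by a weak `c₁` transition followed by a weak `c₂` transition. -/
def Stutter (c₁ c₂ : Cap (Id N 0)) : Proc N 0 → Proc N 0 → Prop :=
  Relation.ReflTransGen (fun P P' => ∃ A, Weak (CapStep c₁) P A ∧ Weak (CapStep c₂) A P')

/-- The relation `⇛cap`: internal reductions, followed by stuttering of the kind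
`out n, in n` for `in n`, and of the kind `in n, out n` for `out n`. -/
def Evolve (c : Cap (Id N 0)) (P P' : Proc N 0) : Prop :=
  match c with
  | .enter n => ∃ A, Reds P A ∧ Stutter (.exit n) (.enter n) A P'
  | .exit n => ∃ A, Reds P A ∧ Stutter (.enter n) (.exit n) A P'
  | .dissolve _ => Reds P P'

/-! ### Intensional bisimilarity -/

/-- Intensional bisimulations. -/
structure IsIntBisimulation (R : Proc N 0 → Proc N 0 → Prop) : Prop where
  symm : ∀ {P Q}, R P Q → R Q P
  par : ∀ {P Q}, R P Q → ∀ P₁ P₂, SC P (.par P₁ P₂) →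
    ∃ Q₁ Q₂, SC Q (.par Q₁ Q₂) ∧ R P₁ Q₁ ∧ R P₂ Q₂
  nil : ∀ {P Q}, R P Q → SC P .nil → SC Q .nil
  tau : ∀ {P Q}, R P Q → ∀ P', Red P P' → ∃ Q', Reds Q Q' ∧ R P' Q'
  enter : ∀ {P Q}, R P Q → ∀ n P', CapStep (.enter n) P P' →
    ∃ A Q', Weak (CapStep (.enter n)) Q A ∧ Stutter (.exit n) (.enter n) A Q' ∧ R P' Q'
  exit : ∀ {P Q}, R P Q → ∀ n P', CapStep (.exit n) P P' →
    ∃ A Q', Weak (CapStep (.exit n)) Q A ∧ Stutter (.enter n) (.exit n) A Q' ∧ R P' Q'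
  dissolve : ∀ {P Q}, R P Q → ∀ n P', CapStep (.dissolve n) P P' →
    ∃ Q', Weak (CapStep (.dissolve n)) Q Q' ∧ R P' Q'
  msg : ∀ {P Q}, R P Q → ∀ n P', MsgStep n P P' → ∃ Q', Weak (MsgStep n) Q Q' ∧ R P' Q'
  input : ∀ {P Q}, R P Q → ∀ n P', InStep n P P' → ∃ Q', Reds (.par Q (.msg n)) Q' ∧ R P' Q'
  amb : ∀ {P Q}, R P Q → ∀ n P', SC P (.amb n P') → ∃ Q', SC Q (.amb n Q') ∧ R P' Q'

/-- Intensional bisimilarity, the largest intensional bisimulation. -/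
def IntBisim (P Q : Proc N 0) : Prop := ∃ R, IsIntBisimulation R ∧ R P Q

/-! ### Eta law, sequentiality degree and the order `<` on processes -/

/-- `P ⟶η Q`: `Q` is obtained from `P` by applying the law `(x)((x)P | ⟨x⟩) = (x)P` once, from left
to right, to a subterm, modulo `≡`. -/
inductive EtaStep : {k : ℕ} → Proc N k → Proc N k → Prop
  | eta {k : ℕ} (P : Proc N (k + 1)) :
      EtaStep (.abs (.par (Proc.abs P).weaken (.msg (.inr 0)))) (.abs P)
  | parLeft {k : ℕ} {P P' : Proc N k} (Q : Proc N k) :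
      EtaStep P P' → EtaStep (.par P Q) (.par P' Q)
  | parRight {k : ℕ} (P : Proc N k) {Q Q' : Proc N k} :
      EtaStep Q Q' → EtaStep (.par P Q) (.par P Q')
  | repl {k : ℕ} {P P' : Proc N k} : EtaStep P P' → EtaStep (.repl P) (.repl P')
  | pre {k : ℕ} (c : Cap (Id N k)) {P P' : Proc N k} :
      EtaStep P P' → EtaStep (.pre c P) (.pre c P')
  | amb {k : ℕ} (η : Id N k) {P P' : Proc N k} : EtaStep P P' → EtaStep (.amb η P) (.amb η P')
  | abs {k : ℕ} {P P' : Proc N (k + 1)} : EtaStep P P' → EtaStep (.abs P) (.abs P')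
  | str {k : ℕ} {P P' P'' P''' : Proc N k} :
      SC P P' → EtaStep P' P'' → SC P'' P''' → EtaStep P P'''

/-- `Q` is an eta normal form of `P`. -/
def IsEtaNF {k : ℕ} (P Q : Proc N k) : Prop :=
  Relation.ReflTransGen EtaStep P Q ∧ ∀ Q', ¬ EtaStep Q Q'

/-- `HasSd P a`: the clauses for the sequentiality degree assign the value `a` to `P`. -/
inductive HasSd : {k : ℕ} → Proc N k → ℕ → Prop
  | nil {k : ℕ} : HasSd (.nil : Proc N k) 0
  | par {k : ℕ} {P Q : Proc N k} {a b : ℕ} : HasSd P a → HasSd Q b → HasSd (.par P Q) (max a b)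
  | amb {k : ℕ} (η : Id N k) {P : Proc N k} {a : ℕ} : HasSd P a → HasSd (.amb η P) a
  | repl {k : ℕ} {P : Proc N k} {a : ℕ} : HasSd P a → HasSd (.repl P) a
  | pre {k : ℕ} (c : Cap (Id N k)) {P : Proc N k} {a : ℕ} : HasSd P a → HasSd (.pre c P) (1 + a)
  | msg {k : ℕ} (η : Id N k) : HasSd (.msg η) 1
  | abs {k : ℕ} {P P' : Proc N (k + 1)} {a : ℕ} :
      IsEtaNF (.abs P) (.abs P') → HasSd P' a → HasSd (.abs P) (a + 1)

/-- The sequentiality degree: the (unique) value assigned by the clauses above. -/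
noncomputable def Proc.sd {k : ℕ} (P : Proc N k) : ℕ := sInf {a | HasSd P a}

/-- Immediate subterms. A subterm of a closed process may have free variables, so subterms are
taken among the processes with an arbitrary number of variables in scope. -/
inductive ImmediateSubterm : (Σ k, Proc N k) → (Σ k, Proc N k) → Prop
  | parLeft {k : ℕ} (P Q : Proc N k) : ImmediateSubterm ⟨k, P⟩ ⟨k, .par P Q⟩
  | parRight {k : ℕ} (P Q : Proc N k) : ImmediateSubterm ⟨k, Q⟩ ⟨k, .par P Q⟩
  | repl {k : ℕ} (P : Proc N k) : ImmediateSubterm ⟨k, P⟩ ⟨k, .repl P⟩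
  | pre {k : ℕ} (c : Cap (Id N k)) (P : Proc N k) : ImmediateSubterm ⟨k, P⟩ ⟨k, .pre c P⟩
  | amb {k : ℕ} (η : Id N k) (P : Proc N k) : ImmediateSubterm ⟨k, P⟩ ⟨k, .amb η P⟩
  | abs {k : ℕ} (P : Proc N (k + 1)) : ImmediateSubterm ⟨k + 1, P⟩ ⟨k, .abs P⟩

/-- `P < Q`: either `sd P < sd Q`, or `P` is a strict subterm of `Q`. -/
def ProcLT (P Q : Σ k, Proc N k) : Prop :=
  P.2.sd < Q.2.sd ∨ Relation.TransGen ImmediateSubterm P Q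

/-! ### The inductive relation `∼ind` -/

/-- The right-hand sides of the clauses that define `P ∼ind Q`, by cases on `P`, in which the
recursive occurrences of `∼ind` are replaced by `R`. -/
def IndClause (R : Proc N 0 → Proc N 0 → Prop) (P Q : Proc N 0) : Prop :=
  match P with
  | .nil => SC Q .nil
  | .amb n P => ∃ Q', SC Q (.amb n Q') ∧ R P Q'
  | .par P₁ P₂ => ∃ Q₁ Q₂, SC Q (.par Q₁ Q₂) ∧ R P₁ Q₁ ∧ R P₂ Q₂
  | .repl P => ∃ L₁ L₂ : List (Proc N 0), L₁ ≠ [] ∧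
      SC Q (.par (Proc.parList (L₁.map Proc.repl)) (Proc.parList L₂)) ∧
      (∀ Q' ∈ L₁, R P Q') ∧ ∀ Q' ∈ L₂, R P Q'
  | .pre c P => ∃ Q', SC Q (.pre c Q') ∧
      (∃ P'', Evolve c P P'' ∧ R P'' Q') ∧ ∃ Q'', Evolve c Q' Q'' ∧ R Q'' P
  | .msg n => SC Q (.msg n)
  | .abs P => ∃ (Q' : Proc N 1) (m : N), m ∉ P.fn ∪ Q.fn ∧ SC Q (.abs Q') ∧
      (∃ Q'', Reds (.par Q (.msg (.inl m))) Q'' ∧ R Q'' (P.inst (.inl m))) ∧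
      ∃ P'', Reds (.par (.abs P) (.msg (.inl m))) P'' ∧ R P'' (Q'.inst (.inl m))

/-- The recursive definition `R P Q :⇔ F R P Q` of a binary relation is well founded: for some
well-founded relation `lt` on pairs, `F R P Q` only depends on the values of `R` at pairs that are
`lt`-smaller than `(P, Q)`. -/
def IsWellFoundedRecursion {α : Type u} (F : (α → α → Prop) → α → α → Prop) : Prop :=
  ∃ lt : α × α → α × α → Prop, WellFounded lt ∧
    ∀ (R S : α → α → Prop) (P Q : α),
      (∀ P' Q', lt (P', Q') (P, Q) → (R P' Q' ↔ S P' Q')) → (F R P Q ↔ F S P Q)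

end MA

/-!
The proof works with processes modulo structural congruence (`PQ`). These form a commutative monoid
under parallel composition, and the monoid is known completely: a process is determined by the
multiplicities in `ℕ ∪ {∞}` of its prime components `cap.P`, `η[P]`, `⟨η⟩`, `(x)P`, where
replication multiplies multiplicities by `∞` (`PQ.comps`, `PQ.ofComps`). Hence decompositions of a
process have common refinements, primes are irreducible, and decompositions of a renamed process
lift along the renaming, even when names are identified.

*The order.* Whether `(x)P` is an eta redex up to `≡` can be read off the number of components of
`P` of certain kinds (`Proc.IsEtaBody`). These numbers are invariant under `≡` and under eta steps,
so the sequentiality degree can be computed by structural recursion (`Proc.seqDeg`), without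
confluence of the eta law. It is monotone on subterms, which makes `<` well founded.

*The recursion.* The number of nested prefixes, all abstractions being counted, is invariant under
`≡`, and no reduction or transition increases it (`Proc.depth`). In every clause the sum of the
depths of the two processes decreases, or else it does not increase and the left-hand process is
replaced by a strict subterm. A well-founded recursion has at most one solution, so it remains to
show that intensional bisimilarity satisfies the clauses.

*Bisimilarity.* In an intensional bisimulation that is closed under parallel composition and
ambients, the clause for reductions follows from the other ones (`IsCore.tau`): the processes taking
part in a reduction are components, they are matched by components, and the stuttering allowed after
`in` and `out` becomes a sequence of reductions in which an ambient keeps entering and leaving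
another one. The remaining clauses (`IsCore`) are inherited by the closure of a relation under
contexts (`IsCore.ctxClosure`) and by its closure under substitutions (`IsCore.renClosure`). So
bisimilarity is a congruence for parallel composition, ambients and replication, and is closed under
substitutions; the latter reduces the clause for `(x)P` to one fresh name. This gives one direction
of every clause. For the other direction, a process bisimilar to a prime is a prime of the same
kind. If `!x` is bisimilar to `y = !z | q₁ | ⋯ | qₛ` with all `qᵢ` prime, then `!x` is also
bisimilar to `!z`, because a prime component can be removed from `!x` without changing it. Every
prime component of `y` can then be completed, by components of `!z`, to a process bisimilar to `x`
(`QBisim.exists_completion`), which yields the required decomposition of `y`.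
-/

namespace MA
variable {N : Type u}

/-! ### Renaming -/

theorem Id.lift_shift {k l : ℕ} (f : Id N k → Id N l) (η : Id N k) :
    Id.lift f (Id.shift η) = Id.shift (f η) := by
  rcases η with n | i <;> simp [Id.lift, Id.shift]

theorem Id.lift_zero {k l : ℕ} (f : Id N k → Id N l) :
    Id.lift f (.inr 0) = .inr 0 := by
  simp [Id.lift]

theorem Id.eq_zero_or_shift {k : ℕ} (η : Id N (k + 1)) :
    η = .inr 0 ∨ ∃ θ : Id N k, η = Id.shift θ := by
  rcases η with n | i
  · exact .inr ⟨.inl n, rfl⟩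
  · refine Fin.cases (.inl rfl) (fun j => .inr ⟨.inr j, rfl⟩) i

theorem Id.shift_injective {k : ℕ} : Function.Injective (Id.shift : Id N k → Id N (k + 1)) :=
  Sum.map_injective.2 ⟨fun _ _ h => h, Fin.succ_injective k⟩

theorem Id.shift_ne_zero {k : ℕ} (η : Id N k) : Id.shift η ≠ .inr 0 := by
  rcases η with n | i
  · simp [Id.shift]
  · simp [Id.shift, Fin.succ_ne_zero]

theorem Id.lift_comp {k l j : ℕ} (f : Id N k → Id N l) (g : Id N l → Id N j) :
    Id.lift g ∘ Id.lift f = Id.lift (g ∘ f) := by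
  funext η
  rcases Id.eq_zero_or_shift η with rfl | ⟨θ, rfl⟩
  · simp [Id.lift_zero]
  · simp [Id.lift_shift]

theorem Cap.map_map {V W X : Type u} (f : V → W) (g : W → X) (c : Cap V) :
    (c.map f).map g = c.map (g ∘ f) := by
  cases c <;> rfl

theorem Cap.id_map {V W : Type u} (f : V → W) (c : Cap V) : (c.map f).id = f c.id := by
  cases c <;> rfl

theorem Cap.map_congr {V W : Type u} {f g : V → W} {c : Cap V} (h : f c.id = g c.id) :
    c.map f = c.map g := by
  cases c <;> exact congrArg _ h

theorem Proc.rename_rename {k l j : ℕ} (P : Proc N k) (f : Id N k → Id N l)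
    (g : Id N l → Id N j) : (P.rename f).rename g = P.rename (g ∘ f) := by
  induction P generalizing l j with
  | nil => rfl
  | par P Q ihP ihQ => simp [Proc.rename, ihP, ihQ]
  | repl P ih => simp [Proc.rename, ih]
  | pre c P ih => simp [Proc.rename, ih, Cap.map_map]
  | amb η P ih => simp [Proc.rename, ih]
  | msg η => rfl
  | abs P ih => simp [Proc.rename, ih, Id.lift_comp]

/-- The free identifiers (names and variables) of a process. -/
def Proc.ids : {k : ℕ} → Proc N k → Set (Id N k)
  | _, .nil => ∅
  | _, .par P Q => P.ids ∪ Q.ids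
  | _, .repl P => P.ids
  | _, .pre c P => {c.id} ∪ P.ids
  | _, .amb η P => {η} ∪ P.ids
  | _, .msg η => {η}
  | _, .abs P => Id.shift ⁻¹' P.ids

theorem Proc.ids_finite {k : ℕ} (P : Proc N k) : P.ids.Finite := by
  induction P with
  | nil => exact Set.finite_empty
  | par P Q ihP ihQ => exact ihP.union ihQ
  | repl P ih => exact ih
  | pre c P ih => exact (Set.finite_singleton _).union ih
  | amb η P ih => exact (Set.finite_singleton _).union ih
  | msg η => exact Set.finite_singleton _
  | abs P ih => exact ih.preimage Id.shift_injective.injOn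

theorem Id.inl_mem_names {k : ℕ} {n : N} {η : Id N k} : n ∈ Id.names η ↔ .inl n = η := by
  rcases η with m | i <;> simp [Id.names]

theorem Proc.inl_mem_ids {k : ℕ} {P : Proc N k} {n : N} : .inl n ∈ P.ids ↔ n ∈ P.fn := by
  induction P with
  | nil => simp [Proc.ids, Proc.fn]
  | par P Q ihP ihQ => simp [Proc.ids, Proc.fn, ihP, ihQ]
  | repl P ih => simpa [Proc.ids, Proc.fn] using ih
  | pre c P ih => simp [Proc.ids, Proc.fn, ← ih, Id.inl_mem_names]
  | amb η P ih => simp [Proc.ids, Proc.fn, ← ih, Id.inl_mem_names]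
  | msg η => simp [Proc.ids, Proc.fn, Id.inl_mem_names]
  | abs P ih => rw [Proc.fn, ← ih]; rfl

theorem Id.lift_eqOn {k l : ℕ} {f g : Id N k → Id N l} {s : Set (Id N (k + 1))}
    (h : Set.EqOn f g (Id.shift ⁻¹' s)) : Set.EqOn (Id.lift f) (Id.lift g) s := by
  intro η hη
  rcases Id.eq_zero_or_shift η with rfl | ⟨θ, rfl⟩
  · simp [Id.lift_zero]
  · simp [Id.lift_shift, h hη]

theorem Proc.rename_congr {k l : ℕ} {P : Proc N k} {f g : Id N k → Id N l}
    (h : Set.EqOn f g P.ids) : P.rename f = P.rename g := by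
  induction P generalizing l with
  | nil => rfl
  | par P Q ihP ihQ =>
    simp [Proc.rename, ihP (h.mono Set.subset_union_left), ihQ (h.mono Set.subset_union_right)]
  | repl P ih => simp [Proc.rename, ih h]
  | pre c P ih =>
    simp [Proc.rename, ih (h.mono Set.subset_union_right),
      Cap.map_congr (h (Set.mem_union_left _ (Set.mem_singleton _)))]
  | amb η P ih =>
    simp [Proc.rename, ih (h.mono Set.subset_union_right),
      h (Set.mem_union_left _ (Set.mem_singleton _))]
  | msg η => simp [Proc.rename, h (Set.mem_singleton _)]
  | abs P ih => simp [Proc.rename, ih (Id.lift_eqOn h)]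

theorem Id.lift_id {k : ℕ} : Id.lift (id : Id N k → Id N k) = id := by
  funext η
  rcases Id.eq_zero_or_shift η with rfl | ⟨θ, rfl⟩
  · simp [Id.lift_zero]
  · simp [Id.lift_shift]

theorem Proc.rename_id {k : ℕ} (P : Proc N k) : P.rename id = P := by
  induction P with
  | nil => rfl
  | par P Q ihP ihQ => simp [Proc.rename, ihP, ihQ]
  | repl P ih => simp [Proc.rename, ih]
  | pre c P ih => cases c <;> simp [Proc.rename, ih, Cap.map]
  | amb η P ih => simp [Proc.rename, ih]
  | msg η => rfl
  | abs P ih => simp [Proc.rename, Id.lift_id, ih]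

theorem Proc.ids_rename {k l : ℕ} (P : Proc N k) (f : Id N k → Id N l) :
    (P.rename f).ids = f '' P.ids := by
  induction P generalizing l with
  | nil => simp [Proc.rename, Proc.ids]
  | par P Q ihP ihQ => simp [Proc.rename, Proc.ids, ihP, ihQ, Set.image_union]
  | repl P ih => simp [Proc.rename, Proc.ids, ih]
  | pre c P ih => simp [Proc.rename, Proc.ids, ih, Cap.id_map, Set.image_insert_eq]
  | amb η P ih => simp [Proc.rename, Proc.ids, ih, Set.image_insert_eq]
  | msg η => simp [Proc.rename, Proc.ids]
  | abs P ih =>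
    ext η
    simp only [Proc.rename, Proc.ids, ih, Set.mem_preimage, Set.mem_image]
    constructor
    · rintro ⟨θ, hθ, e⟩
      rcases Id.eq_zero_or_shift θ with rfl | ⟨ζ, rfl⟩
      · rw [Id.lift_zero] at e
        exact absurd e.symm (Id.shift_ne_zero η)
      · rw [Id.lift_shift] at e
        exact ⟨ζ, hθ, Id.shift_injective e⟩
    · rintro ⟨θ, hθ, rfl⟩
      exact ⟨_, hθ, Id.lift_shift f θ⟩

/-- A process is a renaming along `f` as soon as all its free identifiers are in the range
of `f`. -/
theorem Proc.exists_rename_eq {k l : ℕ} {P : Proc N l} {f : Id N k → Id N l}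
    (h : P.ids ⊆ Set.range f) : ∃ Q : Proc N k, Q.rename f = P := by
  induction P generalizing k with
  | nil => exact ⟨.nil, rfl⟩
  | par P Q ihP ihQ =>
    obtain ⟨P', rfl⟩ := ihP (Set.subset_union_left.trans h)
    obtain ⟨Q', rfl⟩ := ihQ (Set.subset_union_right.trans h)
    exact ⟨.par P' Q', rfl⟩
  | repl P ih =>
    obtain ⟨P', rfl⟩ := ih h
    exact ⟨.repl P', rfl⟩
  | pre c P ih =>
    obtain ⟨P', rfl⟩ := ih (Set.subset_union_right.trans h)
    obtain ⟨η, hη⟩ := h (Set.mem_union_left _ (Set.mem_singleton _))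
    cases c <;> simp only [Cap.id] at hη <;> subst hη
    exacts [⟨.pre (.enter η) P', rfl⟩, ⟨.pre (.exit η) P', rfl⟩, ⟨.pre (.dissolve η) P', rfl⟩]
  | amb η P ih =>
    obtain ⟨P', rfl⟩ := ih (Set.subset_union_right.trans h)
    obtain ⟨θ, rfl⟩ := h (Set.mem_union_left _ (Set.mem_singleton _))
    exact ⟨.amb θ P', rfl⟩
  | msg η =>
    obtain ⟨θ, rfl⟩ := h (Set.mem_singleton _)
    exact ⟨.msg θ, rfl⟩
  | abs P ih =>
    obtain ⟨P', rfl⟩ := ih (f := Id.lift f) fun η hη => by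
      rcases Id.eq_zero_or_shift η with rfl | ⟨θ, rfl⟩
      · exact ⟨_, Id.lift_zero f⟩
      · obtain ⟨ζ, rfl⟩ := h (show θ ∈ (Proc.abs P).ids from hη)
        exact ⟨_, Id.lift_shift f ζ⟩
    exact ⟨.abs P', rfl⟩

theorem Proc.rename_inst {k l : ℕ} (P : Proc N (k + 1)) (η : Id N k) (f : Id N k → Id N l) :
    (P.inst η).rename f = (P.rename (Id.lift f)).inst (f η) := by
  rw [Proc.inst, Proc.inst, Proc.rename_rename, Proc.rename_rename]
  congr 1
  funext θ
  rcases Id.eq_zero_or_shift θ with rfl | ⟨ζ, rfl⟩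
  · simp [Id.lift_zero]
  · rcases ζ with n | i <;> simp only [Function.comp, Id.lift_shift]
    · rcases h : f (.inl n) with m | j <;> simp [Id.shift, h]
    · rcases h : f (.inr i) with m | j <;> simp [Id.shift, h]

theorem SC.rename {k l : ℕ} {P Q : Proc N k} (h : SC P Q) (f : Id N k → Id N l) :
    SC (P.rename f) (Q.rename f) := by
  induction h generalizing l with
  | refl P => exact .refl _
  | symm _ ih => exact (ih f).symm
  | trans _ _ ih₁ ih₂ => exact (ih₁ f).trans (ih₂ f)
  | par _ _ ih₁ ih₂ => exact .par (ih₁ f) (ih₂ f)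
  | repl _ ih => exact .repl (ih f)
  | pre c _ ih => exact .pre _ (ih f)
  | amb η _ ih => exact .amb _ (ih f)
  | abs _ ih => exact .abs (ih _)
  | parNil P => exact .parNil _
  | parComm P Q => exact .parComm _ _
  | parAssoc P Q R => exact .parAssoc _ _ _
  | replUnfold P => exact .replUnfold _
  | replNil => exact .replNil
  | replPar P Q => exact .replPar _ _
  | replRepl P => exact .replRepl _

theorem SC.ids_eq {k : ℕ} {P Q : Proc N k} (h : SC P Q) : P.ids = Q.ids := by
  induction h with
  | refl P => rfl
  | symm _ ih => exact ih.symm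
  | trans _ _ ih₁ ih₂ => exact ih₁.trans ih₂
  | par _ _ ih₁ ih₂ => simp [Proc.ids, ih₁, ih₂]
  | repl _ ih => simpa [Proc.ids] using ih
  | pre c _ ih => simp [Proc.ids, ih]
  | amb η _ ih => simp [Proc.ids, ih]
  | abs _ ih => simp [Proc.ids, ih]
  | parNil P => simp [Proc.ids]
  | parComm P Q => simp [Proc.ids, Set.union_comm]
  | parAssoc P Q R => simp [Proc.ids, Set.union_assoc]
  | replUnfold P => simp [Proc.ids]
  | replNil => simp [Proc.ids]
  | replPar P Q => simp [Proc.ids]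
  | replRepl P => simp [Proc.ids]

/-! ### Processes modulo structural congruence -/

/-- Structural congruence as a setoid. -/
def scSetoid (N : Type u) (k : ℕ) : Setoid (Proc N k) :=
  ⟨SC, ⟨SC.refl, SC.symm, SC.trans⟩⟩

/-- Processes modulo structural congruence. They form a commutative monoid under parallel
composition. -/
def PQ (N : Type u) (k : ℕ) : Type u := Quotient (scSetoid N k)

namespace PQ

/-- The class of a process modulo structural congruence. -/
def mk {k : ℕ} (P : Proc N k) : PQ N k := Quotient.mk (scSetoid N k) P

theorem mk_eq_mk {k : ℕ} {P Q : Proc N k} : mk P = mk Q ↔ SC P Q :=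
  ⟨fun h => Quotient.exact h, fun h => Quotient.sound (s := scSetoid N k) h⟩

theorem exists_mk {k : ℕ} (x : PQ N k) : ∃ P, mk P = x := Quotient.exists_rep x

/-- The class of `!P`. -/
def repl {k : ℕ} : PQ N k → PQ N k :=
  Quotient.map' (s₁ := scSetoid N k) (s₂ := scSetoid N k) Proc.repl fun _ _ h => SC.repl h

/-- The class of `cap.P`. -/
def pre {k : ℕ} (c : Cap (Id N k)) : PQ N k → PQ N k :=
  Quotient.map' (s₁ := scSetoid N k) (s₂ := scSetoid N k) (Proc.pre c) fun _ _ h => SC.pre c h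

/-- The class of `η[P]`. -/
def amb {k : ℕ} (η : Id N k) : PQ N k → PQ N k :=
  Quotient.map' (s₁ := scSetoid N k) (s₂ := scSetoid N k) (Proc.amb η) fun _ _ h => SC.amb η h

/-- The class of `⟨η⟩`. -/
def msg {k : ℕ} (η : Id N k) : PQ N k := mk (.msg η)

/-- The class of `(x)P`. -/
def abs {k : ℕ} : PQ N (k + 1) → PQ N k :=
  Quotient.map' (s₁ := scSetoid N (k + 1)) (s₂ := scSetoid N k) Proc.abs fun _ _ h => SC.abs h

/-- Renaming of classes. -/
def rename {k l : ℕ} (f : Id N k → Id N l) : PQ N k → PQ N l :=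
  Quotient.map' (s₁ := scSetoid N k) (s₂ := scSetoid N l) (Proc.rename f)
    fun _ _ h => SC.rename h f

/-- The class of `P{η/x}`. -/
def inst {k : ℕ} (x : PQ N (k + 1)) (η : Id N k) : PQ N k :=
  rename (Sum.elim Sum.inl (Fin.cases η Sum.inr)) x

instance {k : ℕ} : Zero (PQ N k) := ⟨mk .nil⟩

instance {k : ℕ} : Add (PQ N k) :=
  ⟨Quotient.map₂ (sa := scSetoid N k) (sb := scSetoid N k) (sc := scSetoid N k) Proc.par
    fun _ _ h _ _ h' => SC.par h h'⟩

theorem mk_nil {k : ℕ} : mk (.nil : Proc N k) = 0 := rfl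
theorem mk_par {k : ℕ} (P Q : Proc N k) : mk (.par P Q) = mk P + mk Q := rfl
theorem mk_repl {k : ℕ} (P : Proc N k) : mk (.repl P) = repl (mk P) := rfl
theorem mk_pre {k : ℕ} (c : Cap (Id N k)) (P : Proc N k) : mk (.pre c P) = pre c (mk P) := rfl
theorem mk_amb {k : ℕ} (η : Id N k) (P : Proc N k) : mk (.amb η P) = amb η (mk P) := rfl
theorem mk_msg {k : ℕ} (η : Id N k) : mk (.msg η) = msg η := rfl
theorem mk_abs {k : ℕ} (P : Proc N (k + 1)) : mk (.abs P) = abs (mk P) := rfl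
theorem mk_rename {k l : ℕ} (P : Proc N k) (f : Id N k → Id N l) :
    mk (P.rename f) = rename f (mk P) := rfl
theorem mk_inst {k : ℕ} (P : Proc N (k + 1)) (η : Id N k) : mk (P.inst η) = inst (mk P) η := rfl

instance {k : ℕ} : AddCommMonoid (PQ N k) where
  add_assoc x y z := by
    obtain ⟨P, rfl⟩ := exists_mk x
    obtain ⟨Q, rfl⟩ := exists_mk y
    obtain ⟨R, rfl⟩ := exists_mk z
    exact (mk_eq_mk.2 (SC.parAssoc P Q R)).symm
  zero_add x := by
    obtain ⟨P, rfl⟩ := exists_mk x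
    exact mk_eq_mk.2 ((SC.parComm _ _).trans (SC.parNil P))
  add_zero x := by
    obtain ⟨P, rfl⟩ := exists_mk x
    exact mk_eq_mk.2 (SC.parNil P)
  add_comm x y := by
    obtain ⟨P, rfl⟩ := exists_mk x
    obtain ⟨Q, rfl⟩ := exists_mk y
    exact mk_eq_mk.2 (SC.parComm P Q)
  nsmul := nsmulRec

theorem repl_zero {k : ℕ} : repl (0 : PQ N k) = 0 := mk_eq_mk.2 SC.replNil

theorem repl_add {k : ℕ} (x y : PQ N k) : repl (x + y) = repl x + repl y := by
  obtain ⟨P, rfl⟩ := exists_mk x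
  obtain ⟨Q, rfl⟩ := exists_mk y
  exact mk_eq_mk.2 (SC.replPar P Q)

theorem repl_repl {k : ℕ} (x : PQ N k) : repl (repl x) = repl x := by
  obtain ⟨P, rfl⟩ := exists_mk x
  exact mk_eq_mk.2 (SC.replRepl P)

theorem repl_add_self {k : ℕ} (x : PQ N k) : repl x + x = repl x := by
  obtain ⟨P, rfl⟩ := exists_mk x
  exact (mk_eq_mk.2 (SC.replUnfold P)).symm

theorem repl_add_repl {k : ℕ} (x : PQ N k) : repl x + repl x = repl x := by
  simpa only [repl_repl] using repl_add_self (repl x)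

/-- A replicated process absorbs replicated copies of its parallel components. -/
theorem repl_absorb {k : ℕ} {x y z : PQ N k} (h : repl x = y + z) : repl x + repl y = repl x := by
  have h' : repl x = repl y + repl z := by rw [← repl_repl x, h, repl_add]
  rw [h', add_right_comm, repl_add_repl]

theorem rename_zero {k l : ℕ} (f : Id N k → Id N l) : rename f 0 = 0 := rfl

theorem rename_add {k l : ℕ} (f : Id N k → Id N l) (x y : PQ N k) :
    rename f (x + y) = rename f x + rename f y := by
  obtain ⟨P, rfl⟩ := exists_mk x
  obtain ⟨Q, rfl⟩ := exists_mk y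
  rfl

theorem rename_repl {k l : ℕ} (f : Id N k → Id N l) (x : PQ N k) :
    rename f (repl x) = repl (rename f x) := by
  obtain ⟨P, rfl⟩ := exists_mk x
  rfl

theorem rename_pre {k l : ℕ} (f : Id N k → Id N l) (c : Cap (Id N k)) (x : PQ N k) :
    rename f (pre c x) = pre (c.map f) (rename f x) := by
  obtain ⟨P, rfl⟩ := exists_mk x
  rfl

theorem rename_amb {k l : ℕ} (f : Id N k → Id N l) (η : Id N k) (x : PQ N k) :
    rename f (amb η x) = amb (f η) (rename f x) := by
  obtain ⟨P, rfl⟩ := exists_mk x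
  rfl

theorem rename_msg {k l : ℕ} (f : Id N k → Id N l) (η : Id N k) :
    rename f (msg η) = msg (f η) := rfl

theorem rename_abs {k l : ℕ} (f : Id N k → Id N l) (x : PQ N (k + 1)) :
    rename f (abs x) = abs (rename (Id.lift f) x) := by
  obtain ⟨P, rfl⟩ := exists_mk x
  rfl

theorem rename_inst {k l : ℕ} (f : Id N k → Id N l) (x : PQ N (k + 1)) (η : Id N k) :
    rename f (inst x η) = inst (rename (Id.lift f) x) (f η) := by
  obtain ⟨P, rfl⟩ := exists_mk x
  exact congrArg mk (P.rename_inst η f)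

theorem rename_nsmul {k l : ℕ} (f : Id N k → Id N l) (n : ℕ) (x : PQ N k) :
    rename f (n • x) = n • rename f x := by
  induction n with
  | zero => simp [rename_zero]
  | succ n ih => simp [succ_nsmul, rename_add, ih]

end PQ

/-! ### Prime components and unique decomposition -/

/-- The shapes of prime processes `cap.P`, `η[P]`, `⟨η⟩`, `(x)P`, where `P` is taken modulo
structural congruence. -/
inductive Prime (N : Type u) (k : ℕ) : Type u
  | pre (c : Cap (Id N k)) (x : PQ N k) : Prime N k
  | amb (η : Id N k) (x : PQ N k) : Prime N k
  | msg (η : Id N k) : Prime N k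
  | abs (x : PQ N (k + 1)) : Prime N k

/-- The process described by a prime shape. -/
def Prime.toPQ {k : ℕ} : Prime N k → PQ N k
  | .pre c x => PQ.pre c x
  | .amb η x => PQ.amb η x
  | .msg η => PQ.msg η
  | .abs x => PQ.abs x

/-- Renaming of prime shapes. -/
def Prime.rename {k l : ℕ} (f : Id N k → Id N l) : Prime N k → Prime N l
  | .pre c x => .pre (c.map f) (PQ.rename f x)
  | .amb η x => .amb (f η) (PQ.rename f x)
  | .msg η => .msg (f η)
  | .abs x => .abs (PQ.rename (Id.lift f) x)

theorem Prime.rename_toPQ {k l : ℕ} (f : Id N k → Id N l) (q : Prime N k) :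
    PQ.rename f q.toPQ = (q.rename f).toPQ := by
  cases q with
  | pre c x => exact PQ.rename_pre f c x
  | amb η x => exact PQ.rename_amb f η x
  | msg η => rfl
  | abs x => exact PQ.rename_abs f x

/-- Multiplication by `∞` of multiplicities. -/
noncomputable def topMul {α : Type u} : (α →₀ ℕ∞) →+ (α →₀ ℕ∞) :=
  Finsupp.mapRange.addMonoidHom (AddMonoidHom.mulLeft (⊤ : ℕ∞))

theorem topMul_apply {α : Type u} (f : α →₀ ℕ∞) (a : α) : topMul f a = ⊤ * f a := rfl

theorem topMul_single {α : Type u} (a : α) (n : ℕ∞) :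
    topMul (Finsupp.single a n) = Finsupp.single a (⊤ * n) :=
  Finsupp.mapRange_single (hf := by simp)

theorem ENat.top_mul_add_self (n : ℕ∞) : ⊤ * n + n = ⊤ * n := by
  rcases eq_or_ne n 0 with rfl | h
  · simp
  · simp [ENat.top_mul h]

theorem ENat.top_mul_top_mul (n : ℕ∞) : ⊤ * (⊤ * n) = ⊤ * n := by
  rcases eq_or_ne n 0 with rfl | h
  · simp
  · simp [ENat.top_mul h]

/-- The multiplicities, in `ℕ ∪ {∞}`, of the prime components of a process. -/
noncomputable def Proc.comps {k : ℕ} : Proc N k → (Prime N k →₀ ℕ∞)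
  | .nil => 0
  | .par P Q => P.comps + Q.comps
  | .repl P => topMul P.comps
  | .pre c P => Finsupp.single (.pre c (PQ.mk P)) 1
  | .amb η P => Finsupp.single (.amb η (PQ.mk P)) 1
  | .msg η => Finsupp.single (.msg η) 1
  | .abs P => Finsupp.single (.abs (PQ.mk P)) 1

theorem SC.comps_eq {k : ℕ} {P Q : Proc N k} (h : SC P Q) : P.comps = Q.comps := by
  induction h with
  | refl P => rfl
  | symm _ ih => exact ih.symm
  | trans _ _ ih₁ ih₂ => exact ih₁.trans ih₂
  | par _ _ ih₁ ih₂ => simp [Proc.comps, ih₁, ih₂]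
  | repl _ ih => simp [Proc.comps, ih]
  | pre c h _ => simp [Proc.comps, PQ.mk_eq_mk.2 h]
  | amb η h _ => simp [Proc.comps, PQ.mk_eq_mk.2 h]
  | abs h _ => simp [Proc.comps, PQ.mk_eq_mk.2 h]
  | parNil P => simp [Proc.comps]
  | parComm P Q => exact add_comm _ _
  | parAssoc P Q R => exact (add_assoc _ _ _).symm
  | replUnfold P =>
    ext a
    simp only [Proc.comps, Finsupp.add_apply, topMul_apply, ENat.top_mul_add_self]
  | replNil => simp [Proc.comps]
  | replPar P Q => simp [Proc.comps]
  | replRepl P =>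
    ext a
    simp only [Proc.comps, topMul_apply, ENat.top_mul_top_mul]

namespace PQ

variable {k l : ℕ}

/-- The multiplicities of the prime components, as an additive map on classes of processes. -/
noncomputable def comps : PQ N k →+ (Prime N k →₀ ℕ∞) where
  toFun := Quotient.lift (s := scSetoid N k) Proc.comps fun _ _ h => SC.comps_eq h
  map_zero' := rfl
  map_add' x y := by
    obtain ⟨P, rfl⟩ := exists_mk x
    obtain ⟨Q, rfl⟩ := exists_mk y
    rfl

theorem comps_repl (x : PQ N k) : comps (repl x) = topMul (comps x) := by
  obtain ⟨P, rfl⟩ := exists_mk x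
  rfl

theorem comps_prime (q : Prime N k) : comps q.toPQ = Finsupp.single q 1 := by
  cases q with
  | pre c x => obtain ⟨P, rfl⟩ := exists_mk x; rfl
  | amb η x => obtain ⟨P, rfl⟩ := exists_mk x; rfl
  | msg η => rfl
  | abs x => obtain ⟨P, rfl⟩ := exists_mk x; rfl

/-- `n` parallel copies of `x`, where `n` may be infinite. -/
def copies (x : PQ N k) : ℕ∞ → PQ N k
  | ⊤ => repl x
  | (n : ℕ) => n • x

theorem copies_top (x : PQ N k) : copies x ⊤ = repl x := rfl
theorem copies_coe (x : PQ N k) (n : ℕ) : copies x n = n • x := rfl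

theorem repl_add_nsmul (x : PQ N k) (n : ℕ) : repl x + n • x = repl x := by
  induction n with
  | zero => simp
  | succ n ih => rw [succ_nsmul, ← add_assoc, ih, repl_add_self]

/-- `PQ.copies` as an additive map. -/
def copiesHom (x : PQ N k) : ℕ∞ →+ PQ N k where
  toFun := copies x
  map_zero' := zero_nsmul x
  map_add' m n := by
    induction m using ENat.recTopCoe with
    | top =>
      induction n using ENat.recTopCoe with
      | top => exact (repl_add_repl x).symm
      | coe n => rw [top_add, copies_top, copies_coe, repl_add_nsmul]
    | coe m =>
      induction n using ENat.recTopCoe with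
      | top => rw [add_top, copies_top, copies_coe, add_comm, repl_add_nsmul]
      | coe n => rw [← Nat.cast_add, copies_coe, copies_coe, copies_coe, add_nsmul]

theorem repl_nsmul_succ (x : PQ N k) (n : ℕ) : repl ((n + 1) • x) = repl x := by
  induction n with
  | zero => simp
  | succ n ih => rw [succ_nsmul, repl_add, ih, repl_add_repl]

theorem repl_copies (x : PQ N k) (n : ℕ∞) : repl (copies x n) = copies x (⊤ * n) := by
  induction n using ENat.recTopCoe with
  | top => rw [copies_top, repl_repl]; rfl
  | coe n =>
    cases n with
    | zero =>
      rw [copies_coe, Nat.cast_zero, mul_zero, zero_nsmul, repl_zero]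
      exact (map_zero (copiesHom x)).symm
    | succ n =>
      rw [copies_coe, repl_nsmul_succ, ENat.top_mul (by simp), copies_top]

/-- The process with given multiplicities of prime components. -/
noncomputable def ofComps : (Prime N k →₀ ℕ∞) →+ PQ N k :=
  Finsupp.liftAddHom fun q => copiesHom q.toPQ

theorem ofComps_single (q : Prime N k) (n : ℕ∞) :
    ofComps (Finsupp.single q n) = copies q.toPQ n :=
  Finsupp.liftAddHom_apply_single _ _ _

theorem ofComps_topMul (f : Prime N k →₀ ℕ∞) : ofComps (topMul f) = repl (ofComps f) := by
  induction f using Finsupp.induction_linear with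
  | zero => simp [repl_zero]
  | add f g hf hg => rw [map_add, map_add, map_add, hf, hg, repl_add]
  | single q n => rw [topMul_single, ofComps_single, ofComps_single, repl_copies]

theorem ofComps_comps (x : PQ N k) : ofComps (comps x) = x := by
  obtain ⟨P, rfl⟩ := exists_mk x
  have prime : ∀ q : Prime N k, ofComps (comps q.toPQ) = q.toPQ := fun q => by
    rw [comps_prime, ofComps_single]
    exact one_nsmul _
  induction P with
  | nil => rw [mk_nil, map_zero, map_zero]
  | par P Q ihP ihQ => rw [mk_par, map_add, map_add, ihP prime, ihQ prime]
  | repl P ih => rw [mk_repl, comps_repl, ofComps_topMul, ih prime]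
  | pre c P ih => exact prime (.pre c (mk P))
  | amb η P ih => exact prime (.amb η (mk P))
  | msg η => exact prime (.msg η)
  | abs P ih => exact prime (.abs (mk P))

theorem comps_copies (q : Prime N k) (n : ℕ∞) :
    comps (copies q.toPQ n) = Finsupp.single q n := by
  induction n using ENat.recTopCoe with
  | top => rw [copies_top, comps_repl, comps_prime, topMul_single, mul_one]
  | coe n => rw [copies_coe, map_nsmul, comps_prime, Finsupp.smul_single, nsmul_one]

theorem comps_ofComps (f : Prime N k →₀ ℕ∞) : comps (ofComps f) = f := by
  induction f using Finsupp.induction_linear with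
  | zero => simp
  | add f g hf hg => rw [map_add, map_add, hf, hg]
  | single q n => rw [ofComps_single, comps_copies]

theorem comps_injective : Function.Injective (comps : PQ N k →+ _) :=
  Function.LeftInverse.injective ofComps_comps

/-- Every process is built from primes and replicated primes by parallel composition. -/
theorem induction_prime {motive : PQ N k → Prop} (x : PQ N k) (zero : motive 0)
    (add : ∀ x y, motive x → motive y → motive (x + y)) (prime : ∀ q : Prime N k, motive q.toPQ)
    (repl : ∀ q : Prime N k, motive (repl q.toPQ)) : motive x := by
  rw [← ofComps_comps x]
  induction comps x using Finsupp.induction_linear with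
  | zero => simpa using zero
  | add f g hf hg => rw [map_add]; exact add _ _ hf hg
  | single q n =>
    rw [ofComps_single]
    induction n using ENat.recTopCoe with
    | top => exact repl q
    | coe n =>
      rw [copies_coe]
      induction n with
      | zero => simpa using zero
      | succ n ih => rw [succ_nsmul]; exact add _ _ ih (prime q)

end PQ

theorem Prime.toPQ_injective {k : ℕ} : Function.Injective (Prime.toPQ : Prime N k → PQ N k) := by
  intro p q h
  have := congrArg PQ.comps h
  rw [PQ.comps_prime, PQ.comps_prime] at this
  exact Finsupp.single_left_injective one_ne_zero this

theorem ENat.exists_refinement {a b c d : ℕ∞} (h : a + b = c + d) :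
    ∃ r s t w : ℕ∞, a = r + s ∧ b = t + w ∧ c = r + t ∧ d = s + w := by
  induction a using ENat.recTopCoe with
  | top =>
    induction c using ENat.recTopCoe with
    | top => exact ⟨⊤, d, b, 0, by simp, by simp, by simp, by simp⟩
    | coe c =>
      have hd : d = ⊤ := by simpa using h.symm
      exact ⟨c, ⊤, 0, b, by simp, by simp, by simp, by simp [hd]⟩
  | coe a =>
    induction c using ENat.recTopCoe with
    | top =>
      have hb : b = ⊤ := by simpa using h
      exact ⟨a, 0, ⊤, d, by simp, by simp [hb], by simp, by simp⟩
    | coe c =>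
      rcases le_total a c with hac | hac
      · obtain ⟨e, rfl⟩ := Nat.exists_eq_add_of_le hac
        refine ⟨a, 0, e, d, by simp, ?_, by simp, by simp⟩
        rw [Nat.cast_add, add_assoc] at h
        exact WithTop.add_left_cancel (ENat.natCast_ne_top a) h
      · obtain ⟨e, rfl⟩ := Nat.exists_eq_add_of_le hac
        refine ⟨c, e, 0, b, by simp, by simp, by simp, ?_⟩
        rw [Nat.cast_add, add_assoc] at h
        exact (WithTop.add_left_cancel (ENat.natCast_ne_top c) h).symm

/-- Finitely supported families of multiplicities have the Riesz refinement property. -/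
theorem Finsupp.exists_refinement {α : Type u} {a b c d : α →₀ ℕ∞} (h : a + b = c + d) :
    ∃ r s t w : α →₀ ℕ∞, a = r + s ∧ b = t + w ∧ c = r + t ∧ d = s + w := by
  choose r s t w h₁ h₂ h₃ h₄ using fun i => ENat.exists_refinement (DFunLike.congr_fun h i)
  have fin : ∀ (f : α → ℕ∞) (g : α →₀ ℕ∞), (∀ i, f i ≠ 0 → g i ≠ 0) → f.support.Finite :=
    fun f g hfg => g.hasFiniteSupport.subset fun i hi => hfg i hi
  refine ⟨.ofSupportFinite r (fin r a fun i hi => ?_), .ofSupportFinite s (fin s a fun i hi => ?_),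
    .ofSupportFinite t (fin t b fun i hi => ?_), .ofSupportFinite w (fin w b fun i hi => ?_),
    Finsupp.ext h₁, Finsupp.ext h₂, Finsupp.ext h₃, Finsupp.ext h₄⟩
  · rw [h₁]; simp [hi]
  · rw [h₁]; simp [hi]
  · rw [h₂]; simp [hi]
  · rw [h₂]; simp [hi]

namespace PQ

variable {k l : ℕ}

/-- Two decompositions of a process in two parts have a common refinement. -/
theorem exists_refinement {a b c d : PQ N k} (h : a + b = c + d) :
    ∃ r s t w : PQ N k, a = r + s ∧ b = t + w ∧ c = r + t ∧ d = s + w := by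
  have h' := congrArg comps h
  rw [map_add, map_add] at h'
  obtain ⟨r, s, t, w, h₁, h₂, h₃, h₄⟩ := Finsupp.exists_refinement h'
  refine ⟨ofComps r, ofComps s, ofComps t, ofComps w, ?_⟩
  simp only [← map_add, ← h₁, ← h₂, ← h₃, ← h₄, ofComps_comps, and_self]

theorem add_eq_zero_left {x y : PQ N k} (h : x + y = 0) : x = 0 := by
  apply comps_injective
  have h' := congrArg comps h
  rw [map_add, map_zero] at h'
  rw [map_zero]
  ext q
  have := DFunLike.congr_fun h' q
  simp only [Finsupp.add_apply, Finsupp.coe_zero, Pi.zero_apply, add_eq_zero] at this ⊢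
  exact this.1

theorem add_eq_zero_right {x y : PQ N k} (h : x + y = 0) : y = 0 :=
  add_eq_zero_left ((add_comm y x).trans h)

theorem prime_ne_zero (q : Prime N k) : q.toPQ ≠ 0 := fun h => by
  have := congrArg comps h
  rw [comps_prime, map_zero, Finsupp.single_eq_zero] at this
  exact one_ne_zero this

/-- The parts of several copies of a prime are made of copies of that prime. -/
theorem copies_eq_add {q : Prime N k} {n : ℕ∞} {x y : PQ N k} (h : copies q.toPQ n = x + y) :
    ∃ i j : ℕ∞, x = copies q.toPQ i ∧ y = copies q.toPQ j ∧ i + j = n := by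
  have h' := congrArg comps h
  rw [map_add, comps_copies] at h'
  have key : ∀ f g : Prime N k →₀ ℕ∞, Finsupp.single q n = f + g → f = Finsupp.single q (f q) := by
    intro f g e
    ext p
    by_cases hp : p = q
    · subst hp; simp
    · have := DFunLike.congr_fun e p
      rw [Finsupp.single_eq_of_ne hp, Finsupp.add_apply] at this
      rw [Finsupp.single_eq_of_ne hp, (add_eq_zero.1 this.symm).1]
  refine ⟨comps x q, comps y q, comps_injective ?_, comps_injective ?_, ?_⟩
  · rw [comps_copies]; exact key _ _ h'
  · rw [comps_copies]; exact key _ _ (h'.trans (add_comm _ _))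
  · have := DFunLike.congr_fun h' q
    rw [Finsupp.single_eq_same, Finsupp.add_apply] at this
    exact this.symm

theorem prime_eq_add {q : Prime N k} {x y : PQ N k} (h : q.toPQ = x + y) :
    (x = 0 ∧ y = q.toPQ) ∨ (x = q.toPQ ∧ y = 0) := by
  have h1 : copies q.toPQ 1 = q.toPQ := one_nsmul _
  have h0 : copies q.toPQ 0 = 0 := zero_nsmul _
  obtain ⟨i, j, rfl, rfl, e⟩ := copies_eq_add (h1.trans h)
  rcases eq_or_ne i 0 with rfl | hi
  · rw [zero_add] at e
    subst e
    exact .inl ⟨h0, h1⟩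
  · rcases eq_or_ne j 0 with rfl | hj
    · rw [add_zero] at e
      subst e
      exact .inr ⟨h1, h0⟩
    · exfalso
      have h2 : (1 : ℕ∞) + 1 ≤ i + j :=
        add_le_add (Order.one_le_iff_pos.2 (pos_iff_ne_zero.2 hi))
          (Order.one_le_iff_pos.2 (pos_iff_ne_zero.2 hj))
      rw [e] at h2
      exact absurd h2 (by decide)

theorem eq_zero_of_repl_eq_zero {x : PQ N k} (h : repl x = 0) : x = 0 :=
  add_eq_zero_right ((repl_add_self x).trans h)

theorem repl_ne_prime (x : PQ N k) (q : Prime N k) : repl x ≠ q.toPQ := fun h => by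
  rcases prime_eq_add ((repl_add_self x).trans h).symm with ⟨h₁, -⟩ | ⟨-, h₂⟩
  · exact prime_ne_zero q (h.symm.trans h₁)
  · rw [h₂, repl_zero] at h
    exact prime_ne_zero q h.symm

/-- Removing one copy of a prime component of `!P` leaves `!P` unchanged, and such a component is a
component of `P`. -/
theorem repl_eq_prime_add {x z : PQ N k} {q : Prime N k} (h : repl x = q.toPQ + z) :
    z = repl x ∧ ∃ y, x = q.toPQ + y := by
  have h' := congrArg comps h
  rw [comps_repl, map_add, comps_prime] at h'
  have hq := DFunLike.congr_fun h' q
  rw [topMul_apply, Finsupp.add_apply, Finsupp.single_eq_same] at hq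
  have hx : comps x q ≠ 0 := fun e => by
    rw [e, mul_zero] at hq
    exact one_ne_zero (add_eq_zero.1 hq.symm).1
  constructor
  · apply comps_injective
    rw [comps_repl]
    ext p
    by_cases hp : p = q
    · subst hp
      rw [topMul_apply, ENat.top_mul hx]
      rw [ENat.top_mul hx] at hq
      simpa using hq.symm
    · have := DFunLike.congr_fun h' p
      rw [Finsupp.add_apply, Finsupp.single_eq_of_ne hp, zero_add] at this
      rw [this]
  · obtain ⟨m, hm⟩ := exists_add_of_le (Order.one_le_iff_pos.2 (pos_iff_ne_zero.2 hx))
    classical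
    refine ⟨ofComps ((comps x).update q m), comps_injective ?_⟩
    rw [map_add, comps_prime, comps_ofComps]
    ext p
    by_cases hp : p = q
    · subst hp
      simp [hm]
    · simp [Finsupp.single_eq_of_ne hp, hp]

theorem exists_prime_add {x : PQ N k} (h : x ≠ 0) : ∃ (q : Prime N k) (y : PQ N k),
    x = q.toPQ + y := by
  induction x using induction_prime with
  | zero => exact absurd rfl h
  | add x y hx hy =>
    by_cases h0 : x = 0
    · rw [h0, zero_add] at h ⊢
      exact hy h
    · obtain ⟨q, z, rfl⟩ := hx h0
      exact ⟨q, z + y, add_assoc _ _ _⟩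
  | prime q => exact ⟨q, 0, (add_zero _).symm⟩
  | repl q => exact ⟨q, repl q.toPQ, by rw [add_comm, repl_add_self]⟩

/-- A process is a replicated product of primes in parallel with a product of primes. -/
theorem exists_prime_lists (x : PQ N k) : ∃ L M : List (Prime N k),
    x = repl (L.map Prime.toPQ).sum + (M.map Prime.toPQ).sum := by
  induction x using induction_prime with
  | zero => exact ⟨[], [], by simp [repl_zero]⟩
  | add x y hx hy =>
    obtain ⟨L, M, rfl⟩ := hx
    obtain ⟨L', M', rfl⟩ := hy
    refine ⟨L ++ L', M ++ M', ?_⟩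
    simp only [List.map_append, List.sum_append, repl_add]
    abel
  | prime q => exact ⟨[], [q], by simp [repl_zero]⟩
  | repl q => exact ⟨[q], [], by simp⟩

/-! ### Renaming reflects the decomposition into components -/

theorem rename_copies (f : Id N k → Id N l) (x : PQ N k) (n : ℕ∞) :
    rename f (copies x n) = copies (rename f x) n := by
  induction n using ENat.recTopCoe with
  | top => exact rename_repl f x
  | coe n => exact rename_nsmul f n x

theorem eq_zero_of_rename_eq_zero {f : Id N k → Id N l} {x : PQ N k} (h : rename f x = 0) :
    x = 0 := by
  by_contra h0
  obtain ⟨q, y, rfl⟩ := exists_prime_add h0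
  rw [rename_add, Prime.rename_toPQ] at h
  exact prime_ne_zero _ (add_eq_zero_left h)

theorem exists_of_rename_eq_prime {f : Id N k → Id N l} {x : PQ N k} {q : Prime N l}
    (h : rename f x = q.toPQ) : ∃ p : Prime N k, x = p.toPQ ∧ p.rename f = q := by
  have h0 : x ≠ 0 := fun e => prime_ne_zero q (by rw [← h, e, rename_zero])
  obtain ⟨p, y, rfl⟩ := exists_prime_add h0
  rw [rename_add, Prime.rename_toPQ] at h
  rcases prime_eq_add h.symm with ⟨h₁, -⟩ | ⟨h₁, h₂⟩
  · exact absurd h₁ (prime_ne_zero _)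
  · rw [eq_zero_of_rename_eq_zero h₂, add_zero]
    exact ⟨p, rfl, Prime.toPQ_injective h₁⟩

/-- A decomposition of a renamed process comes from a decomposition of the process, even if the
renaming identifies names. -/
theorem exists_of_rename_eq_add {f : Id N k → Id N l} {x : PQ N k} {y z : PQ N l}
    (h : rename f x = y + z) :
    ∃ y' z', x = y' + z' ∧ rename f y' = y ∧ rename f z' = z := by
  induction x using induction_prime generalizing y z with
  | zero =>
    rw [rename_zero] at h
    exact ⟨0, 0, (add_zero 0).symm, (add_eq_zero_left h.symm).symm,
      (add_eq_zero_right h.symm).symm⟩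
  | add a b iha ihb =>
    rw [rename_add] at h
    obtain ⟨r, s, t, w, h₁, h₂, rfl, rfl⟩ := exists_refinement h
    obtain ⟨r', s', rfl, rfl, rfl⟩ := iha h₁
    obtain ⟨t', w', rfl, rfl, rfl⟩ := ihb h₂
    exact ⟨r' + t', s' + w', by abel, rename_add _ _ _, rename_add _ _ _⟩
  | prime q =>
    rw [Prime.rename_toPQ] at h
    rcases prime_eq_add h with ⟨rfl, rfl⟩ | ⟨rfl, rfl⟩
    · exact ⟨0, q.toPQ, (zero_add _).symm, rfl, Prime.rename_toPQ f q⟩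
    · exact ⟨q.toPQ, 0, (add_zero _).symm, Prime.rename_toPQ f q, rfl⟩
  | repl q =>
    rw [rename_repl, Prime.rename_toPQ] at h
    obtain ⟨i, j, rfl, rfl, e⟩ := copies_eq_add (n := ⊤) h
    refine ⟨copies q.toPQ i, copies q.toPQ j, ?_, ?_, ?_⟩
    · have := map_add (copiesHom q.toPQ) i j
      rw [e] at this
      exact this
    · rw [rename_copies, Prime.rename_toPQ]
    · rw [rename_copies, Prime.rename_toPQ]

end PQ

/-! ### The eta law and the sequentiality degree -/

open Classical in
/-- `P.shape η` counts, with multiplicities in `ℕ ∪ {∞}`, the prime components of `P`, those equal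
to `⟨η⟩`, and those of the form `(x)Q` in which `η` is not free. -/
noncomputable def Proc.shape {k : ℕ} (η : Id N k) : Proc N k → ℕ∞ × ℕ∞ × ℕ∞
  | .nil => 0
  | .par P Q => P.shape η + Q.shape η
  | .repl P => ⊤ * P.shape η
  | .pre _ _ => (1, 0, 0)
  | .amb _ _ => (1, 0, 0)
  | .msg θ => (1, if θ = η then 1 else 0, 0)
  | .abs P => (1, 0, if η ∈ (Proc.abs P).ids then 0 else 1)

theorem ENat.prod_top_mul_add_self (s : ℕ∞ × ℕ∞ × ℕ∞) : ⊤ * s + s = ⊤ * s :=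
  Prod.ext (ENat.top_mul_add_self _)
    (Prod.ext (ENat.top_mul_add_self _) (ENat.top_mul_add_self _))

theorem ENat.prod_top_mul_top_mul (s : ℕ∞ × ℕ∞ × ℕ∞) : ⊤ * (⊤ * s) = ⊤ * s :=
  Prod.ext (ENat.top_mul_top_mul _)
    (Prod.ext (ENat.top_mul_top_mul _) (ENat.top_mul_top_mul _))

theorem SC.shape_eq {k : ℕ} {P Q : Proc N k} (h : SC P Q) (η : Id N k) :
    P.shape η = Q.shape η := by
  induction h with
  | refl P => rfl
  | symm _ ih => exact (ih η).symm
  | trans _ _ ih₁ ih₂ => exact (ih₁ η).trans (ih₂ η)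
  | par _ _ ih₁ ih₂ => simp only [Proc.shape, ih₁, ih₂]
  | repl _ ih => simp only [Proc.shape, ih]
  | pre c _ _ => rfl
  | amb η _ _ => rfl
  | abs h _ => rw [Proc.shape, Proc.shape, (SC.abs h).ids_eq]
  | parNil P => exact add_zero _
  | parComm P Q => exact add_comm _ _
  | parAssoc P Q R => exact (add_assoc _ _ _).symm
  | replUnfold P => exact (ENat.prod_top_mul_add_self _).symm
  | replNil => exact mul_zero _
  | replPar P Q => exact mul_add _ _ _
  | replRepl P => exact ENat.prod_top_mul_top_mul _

theorem EtaStep.ids_eq {k : ℕ} {P Q : Proc N k} (h : EtaStep P Q) : P.ids = Q.ids := by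
  induction h with
  | eta P =>
    ext η
    simp only [Proc.ids, Proc.weaken, Set.mem_preimage, Set.mem_union, Set.mem_singleton_iff]
    have : Id.shift η ≠ .inr 0 := Id.shift_ne_zero η
    rw [or_iff_left this, ← Set.mem_preimage, ← Set.mem_preimage]
    change Id.shift η ∈ ((Proc.abs P).rename Id.shift).ids ↔ η ∈ (Proc.abs P).ids
    rw [Proc.ids_rename, Id.shift_injective.mem_set_image]
  | parLeft Q _ ih => simp only [Proc.ids, ih]
  | parRight P _ ih => simp only [Proc.ids, ih]
  | repl _ ih => simpa only [Proc.ids] using ih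
  | pre c _ ih => simp only [Proc.ids, ih]
  | amb η _ ih => simp only [Proc.ids, ih]
  | abs _ ih => simp only [Proc.ids, ih]
  | str h₁ _ h₂ ih => exact h₁.ids_eq.trans (ih.trans h₂.ids_eq)

theorem EtaStep.shape_eq {k : ℕ} {P Q : Proc N k} (h : EtaStep P Q) (η : Id N k) :
    P.shape η = Q.shape η := by
  induction h with
  | eta P => rw [Proc.shape, Proc.shape, (EtaStep.eta P).ids_eq]
  | parLeft Q _ ih => simp only [Proc.shape, ih]
  | parRight P _ ih => simp only [Proc.shape, ih]
  | repl _ ih => simp only [Proc.shape, ih]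
  | pre c _ ih => rfl
  | amb η _ ih => rfl
  | abs h ih => rw [Proc.shape, Proc.shape, h.abs.ids_eq]
  | str h₁ _ h₂ ih => exact (h₁.shape_eq η).trans ((ih η).trans (h₂.shape_eq η))

theorem Proc.shape_rename {k l : ℕ} (P : Proc N k) {f : Id N k → Id N l} {η : Id N k} {θ : Id N l}
    (h : ∀ ζ, f ζ = θ ↔ ζ = η) : (P.rename f).shape θ = P.shape η := by
  have mem : ∀ Q : Proc N k, θ ∈ (Q.rename f).ids ↔ η ∈ Q.ids := fun Q => by
    simp [Proc.ids_rename, h]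
  induction P with
  | nil => rfl
  | par P Q ihP ihQ => simp only [Proc.rename, Proc.shape, ihP h mem, ihQ h mem]
  | repl P ih => simp only [Proc.rename, Proc.shape, ih h mem]
  | pre c P _ => rfl
  | amb ζ P _ => rfl
  | msg ζ =>
    classical
    exact congrArg (fun t : ℕ∞ => ((1 : ℕ∞), t, (0 : ℕ∞))) (if_congr (h ζ) rfl rfl)
  | abs P _ =>
    have := mem (.abs P)
    simp only [Proc.rename] at this
    rw [Proc.rename, Proc.shape, Proc.shape, propext this]

/-- The body `P` of an abstraction `(x)P` which is an eta redex up to structural congruence: `P`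
consists of `⟨x⟩` and of one abstraction in which `x` is not free. -/
def Proc.IsEtaBody {k : ℕ} (P : Proc N (k + 1)) : Prop := P.shape (.inr 0) = (2, 1, 1)

theorem Proc.isEtaBody_rename {k l : ℕ} (P : Proc N (k + 1)) (f : Id N k → Id N l) :
    (P.rename (Id.lift f)).IsEtaBody ↔ P.IsEtaBody := by
  rw [Proc.IsEtaBody, Proc.IsEtaBody, Proc.shape_rename P (η := .inr 0)]
  intro ζ
  rcases Id.eq_zero_or_shift ζ with rfl | ⟨θ, rfl⟩
  · simp [Id.lift_zero]
  · simp [Id.lift_shift, Id.shift_ne_zero]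

theorem Proc.isEtaBody_eta {k : ℕ} (P : Proc N (k + 1)) :
    (Proc.par (Proc.abs P).weaken (.msg (.inr 0))).IsEtaBody := by
  have h : (.inr 0 : Id N (k + 1)) ∉ ((Proc.abs P).rename Id.shift).ids := by
    rw [Proc.ids_rename]
    rintro ⟨η, -, h⟩
    exact Id.shift_ne_zero η h
  simp only [Proc.rename] at h
  simp only [Proc.IsEtaBody, Proc.weaken, Proc.rename, Proc.shape, h]
  simp [one_add_one_eq_two]

theorem Proc.sc_nil_of_shape {k : ℕ} {P : Proc N k} {η : Id N k} (h : (P.shape η).1 = 0) :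
    SC P .nil := by
  induction P with
  | nil => exact .refl _
  | par P Q ihP ihQ =>
    have h' := add_eq_zero.1 h
    exact (SC.par (ihP h'.1) (ihQ h'.2)).trans (.parNil _)
  | repl P ih =>
    have h' : (⊤ : ℕ∞) * (P.shape η).1 = 0 := h
    refine (SC.repl (ih (η := η) ?_)).trans .replNil
    simpa using h'
  | pre c P _ => exact absurd h one_ne_zero
  | amb θ P _ => exact absurd h one_ne_zero
  | msg θ => exact absurd h one_ne_zero
  | abs P _ => exact absurd h one_ne_zero

theorem Proc.exists_msg_of_shape {k : ℕ} {P : Proc N k} {η : Id N k} (h : (P.shape η).2.1 ≠ 0) :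
    ∃ x, PQ.mk P = PQ.msg η + x := by
  induction P with
  | nil => exact absurd rfl h
  | par P Q ihP ihQ =>
    by_cases h0 : (P.shape η).2.1 = 0
    · have h' : (P.shape η).2.1 + (Q.shape η).2.1 ≠ 0 := h
      rw [h0, zero_add] at h'
      obtain ⟨x, hx⟩ := ihQ h'
      exact ⟨PQ.mk P + x, by rw [PQ.mk_par, hx, add_left_comm]⟩
    · obtain ⟨x, hx⟩ := ihP h0
      exact ⟨x + PQ.mk Q, by rw [PQ.mk_par, hx, add_assoc]⟩
  | repl P ih =>
    have h' : (⊤ : ℕ∞) * (P.shape η).2.1 ≠ 0 := h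
    obtain ⟨x, hx⟩ := ih (right_ne_zero_of_mul h')
    exact ⟨PQ.repl (PQ.mk P) + x,
      by rw [PQ.mk_repl, add_left_comm, ← hx, PQ.repl_add_self]⟩
  | pre c P _ => exact absurd rfl h
  | amb θ P _ => exact absurd rfl h
  | msg θ =>
    simp only [Proc.shape, ne_eq, ite_eq_right_iff, one_ne_zero, imp_false, not_not] at h
    subst h
    exact ⟨0, (add_zero _).symm⟩
  | abs P _ => exact absurd rfl h

theorem Proc.exists_abs_of_shape {k : ℕ} {P : Proc N k} {η : Id N k} (h : (P.shape η).2.2 ≠ 0) :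
    ∃ Q x, η ∉ (Proc.abs Q).ids ∧ PQ.mk P = PQ.mk (.abs Q) + x := by
  induction P with
  | nil => exact absurd rfl h
  | par P Q ihP ihQ =>
    by_cases h0 : (P.shape η).2.2 = 0
    · have h' : (P.shape η).2.2 + (Q.shape η).2.2 ≠ 0 := h
      rw [h0, zero_add] at h'
      obtain ⟨R, x, hR, hx⟩ := ihQ h'
      exact ⟨R, PQ.mk P + x, hR, by rw [PQ.mk_par, hx, add_left_comm]⟩
    · obtain ⟨R, x, hR, hx⟩ := ihP h0
      exact ⟨R, x + PQ.mk Q, hR, by rw [PQ.mk_par, hx, add_assoc]⟩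
  | repl P ih =>
    have h' : (⊤ : ℕ∞) * (P.shape η).2.2 ≠ 0 := h
    obtain ⟨R, x, hR, hx⟩ := ih (right_ne_zero_of_mul h')
    exact ⟨R, PQ.repl (PQ.mk P) + x, hR,
      by rw [PQ.mk_repl, add_left_comm, ← hx, PQ.repl_add_self]⟩
  | pre c P _ => exact absurd rfl h
  | amb θ P _ => exact absurd rfl h
  | msg θ => exact absurd rfl h
  | abs P _ =>
    simp only [Proc.shape, ne_eq, ite_eq_left_iff, one_ne_zero, imp_false, not_not] at h
    exact ⟨P, 0, h, (add_zero _).symm⟩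

/-- An abstraction whose body satisfies `Proc.IsEtaBody` is an eta redex up to `≡`. -/
theorem Proc.IsEtaBody.exists_eta {k : ℕ} {P : Proc N (k + 1)} (h : P.IsEtaBody) :
    ∃ Q : Proc N (k + 1), SC P (.par (Proc.abs Q).weaken (.msg (.inr 0))) := by
  have h21 : (P.shape (.inr 0)).2.1 = 1 := by rw [h]
  obtain ⟨x, hx⟩ := Proc.exists_msg_of_shape (P := P) (η := .inr 0) (by simp [h21])
  obtain ⟨R, rfl⟩ := PQ.exists_mk x
  have hR := (PQ.mk_eq_mk (P := P) (Q := .par (.msg (.inr 0)) R)).1 hx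
  have e := (hR.shape_eq (.inr 0)).symm.trans h
  obtain ⟨Q, y, hQ, hy⟩ := Proc.exists_abs_of_shape (P := R) (η := .inr 0) (fun h0 => by
    have := congrArg (fun s => s.2.2) e
    simp [Proc.shape, h0] at this)
  obtain ⟨T, rfl⟩ := PQ.exists_mk y
  have hT := (PQ.mk_eq_mk (P := R) (Q := .par (.abs Q) T)).1 hy
  have e₁ := congrArg Prod.fst e
  simp only [Proc.shape, hT.shape_eq (.inr 0), Prod.fst_add, ← add_assoc] at e₁
  -- the two components found so far are the only ones
  have hT0 := PQ.mk_eq_mk.2 (Proc.sc_nil_of_shape (P := T) (η := .inr 0)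
    (WithTop.add_left_cancel (ENat.natCast_ne_top 2) (e₁.trans (add_zero 2).symm)))
  obtain ⟨A, hA⟩ := Proc.exists_rename_eq (P := Proc.abs Q) (f := Id.shift) (fun η hη => by
    rcases Id.eq_zero_or_shift η with rfl | ⟨θ, rfl⟩
    · exact absurd hη hQ
    · exact ⟨θ, rfl⟩)
  cases A with
  | abs A =>
    refine ⟨A, PQ.mk_eq_mk.1 ?_⟩
    rw [hx, hy, hT0, PQ.mk_par, Proc.weaken, hA, PQ.mk_nil, add_zero]
    exact add_comm _ _
  | _ => simp [Proc.rename] at hA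

open Classical in
/-- The sequentiality degree, computed without eta normal forms: the prefix of an abstraction that
is an eta redex is not counted. -/
noncomputable def Proc.seqDeg : {k : ℕ} → Proc N k → ℕ
  | _, .nil => 0
  | _, .par P Q => max P.seqDeg Q.seqDeg
  | _, .repl P => P.seqDeg
  | _, .pre _ P => 1 + P.seqDeg
  | _, .amb _ P => P.seqDeg
  | _, .msg _ => 1
  | _, .abs P => if P.IsEtaBody then P.seqDeg else P.seqDeg + 1

theorem SC.isEtaBody_iff {k : ℕ} {P Q : Proc N (k + 1)} (h : SC P Q) :
    P.IsEtaBody ↔ Q.IsEtaBody := by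
  rw [Proc.IsEtaBody, h.shape_eq, Proc.IsEtaBody]

theorem EtaStep.isEtaBody_iff {k : ℕ} {P Q : Proc N (k + 1)} (h : EtaStep P Q) :
    P.IsEtaBody ↔ Q.IsEtaBody := by
  rw [Proc.IsEtaBody, h.shape_eq, Proc.IsEtaBody]

theorem SC.seqDeg_eq {k : ℕ} {P Q : Proc N k} (h : SC P Q) : P.seqDeg = Q.seqDeg := by
  induction h with
  | refl P => rfl
  | symm _ ih => exact ih.symm
  | trans _ _ ih₁ ih₂ => exact ih₁.trans ih₂
  | par _ _ ih₁ ih₂ => simp only [Proc.seqDeg, ih₁, ih₂]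
  | repl _ ih => simpa only [Proc.seqDeg] using ih
  | pre c _ ih => simp only [Proc.seqDeg, ih]
  | amb η _ ih => simpa only [Proc.seqDeg] using ih
  | abs h ih => rw [Proc.seqDeg, Proc.seqDeg, ih, propext h.isEtaBody_iff]
  | parNil P => simp [Proc.seqDeg]
  | parComm P Q => exact max_comm _ _
  | parAssoc P Q R => exact (max_assoc _ _ _).symm
  | replUnfold P => simp [Proc.seqDeg]
  | replNil => rfl
  | replPar P Q => rfl
  | replRepl P => rfl

theorem Proc.seqDeg_rename {k l : ℕ} (P : Proc N k) (f : Id N k → Id N l) :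
    (P.rename f).seqDeg = P.seqDeg := by
  induction P generalizing l with
  | nil => rfl
  | par P Q ihP ihQ => simp only [Proc.rename, Proc.seqDeg, ihP, ihQ]
  | repl P ih => simp only [Proc.rename, Proc.seqDeg, ih]
  | pre c P ih => simp only [Proc.rename, Proc.seqDeg, ih]
  | amb η P ih => simp only [Proc.rename, Proc.seqDeg, ih]
  | msg η => rfl
  | abs P ih =>
    rw [Proc.rename, Proc.seqDeg, Proc.seqDeg, ih, propext (Proc.isEtaBody_rename P f)]

theorem Proc.one_le_seqDeg_abs {k : ℕ} (P : Proc N (k + 1)) : 1 ≤ (Proc.abs P).seqDeg := by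
  rw [Proc.seqDeg]
  split_ifs with h
  · obtain ⟨Q, hQ⟩ := h.exists_eta
    rw [hQ.seqDeg_eq]
    exact le_max_right _ _
  · exact Nat.le_add_left 1 _

theorem EtaStep.seqDeg_eq {k : ℕ} {P Q : Proc N k} (h : EtaStep P Q) : P.seqDeg = Q.seqDeg := by
  induction h with
  | eta P =>
    rw [Proc.seqDeg, if_pos (Proc.isEtaBody_eta P), Proc.seqDeg, Proc.weaken, Proc.seqDeg_rename]
    exact max_eq_left (Proc.one_le_seqDeg_abs P)
  | parLeft Q _ ih => simp only [Proc.seqDeg, ih]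
  | parRight P _ ih => simp only [Proc.seqDeg, ih]
  | repl _ ih => simpa only [Proc.seqDeg] using ih
  | pre c _ ih => simp only [Proc.seqDeg, ih]
  | amb η _ ih => simpa only [Proc.seqDeg] using ih
  | abs h ih => rw [Proc.seqDeg, Proc.seqDeg, ih, propext h.isEtaBody_iff]
  | str h₁ _ h₂ ih => exact h₁.seqDeg_eq.trans (ih.trans h₂.seqDeg_eq)

/-- A process none of whose subterms is an eta redex up to `≡`. -/
def Proc.EtaNormal : {k : ℕ} → Proc N k → Prop
  | _, .nil => True
  | _, .par P Q => P.EtaNormal ∧ Q.EtaNormal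
  | _, .repl P => P.EtaNormal
  | _, .pre _ P => P.EtaNormal
  | _, .amb _ P => P.EtaNormal
  | _, .msg _ => True
  | _, .abs P => P.EtaNormal ∧ ¬ P.IsEtaBody

theorem SC.etaNormal_iff {k : ℕ} {P Q : Proc N k} (h : SC P Q) :
    P.EtaNormal ↔ Q.EtaNormal := by
  induction h with
  | refl P => rfl
  | symm _ ih => exact ih.symm
  | trans _ _ ih₁ ih₂ => exact ih₁.trans ih₂
  | par _ _ ih₁ ih₂ => simp only [Proc.EtaNormal, ih₁, ih₂]
  | repl _ ih => simpa only [Proc.EtaNormal] using ih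
  | pre c _ ih => simpa only [Proc.EtaNormal] using ih
  | amb η _ ih => simpa only [Proc.EtaNormal] using ih
  | abs h ih => simp only [Proc.EtaNormal, ih, h.isEtaBody_iff]
  | parNil P => simp [Proc.EtaNormal]
  | parComm P Q => exact and_comm
  | parAssoc P Q R => exact and_assoc.symm
  | replUnfold P => simp [Proc.EtaNormal]
  | replNil => rfl
  | replPar P Q => rfl
  | replRepl P => rfl

theorem Proc.etaNormal_rename {k l : ℕ} (P : Proc N k) (f : Id N k → Id N l) :
    (P.rename f).EtaNormal ↔ P.EtaNormal := by
  induction P generalizing l with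
  | nil => rfl
  | par P Q ihP ihQ => simp only [Proc.rename, Proc.EtaNormal, ihP, ihQ]
  | repl P ih => simp only [Proc.rename, Proc.EtaNormal, ih]
  | pre c P ih => simp only [Proc.rename, Proc.EtaNormal, ih]
  | amb η P ih => simp only [Proc.rename, Proc.EtaNormal, ih]
  | msg η => rfl
  | abs P ih => simp only [Proc.rename, Proc.EtaNormal, ih, Proc.isEtaBody_rename]

theorem EtaStep.not_etaNormal {k : ℕ} {P Q : Proc N k} (h : EtaStep P Q) : ¬ P.EtaNormal := by
  induction h with
  | eta P => exact fun h => h.2 (Proc.isEtaBody_eta P)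
  | parLeft Q _ ih => exact fun h => ih h.1
  | parRight P _ ih => exact fun h => ih h.2
  | repl _ ih => exact ih
  | pre c _ ih => exact ih
  | amb η _ ih => exact ih
  | abs _ ih => exact fun h => ih h.1
  | str h₁ _ _ ih => exact fun h => ih (h₁.etaNormal_iff.1 h)

theorem Proc.exists_abs_etaNormal {k : ℕ} {P Q : Proc N (k + 1)}
    (h : Relation.ReflTransGen EtaStep P Q) (hQ : Q.EtaNormal) :
    ∃ R : Proc N (k + 1), Relation.ReflTransGen EtaStep (.abs P) (.abs R) ∧
      (Proc.abs R).EtaNormal := by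
  have h' : Relation.ReflTransGen EtaStep (Proc.abs P) (.abs Q) :=
    h.lift Proc.abs fun _ _ => EtaStep.abs
  by_cases hb : Q.IsEtaBody
  · obtain ⟨A, hA⟩ := hb.exists_eta
    refine ⟨A, h'.tail (.str (SC.abs hA) (.eta A) (.refl _)), ?_⟩
    exact (Proc.etaNormal_rename _ _).1 ((hA.etaNormal_iff.1 hQ).1)
  · exact ⟨Q, h', hQ, hb⟩

/-- Every process has an eta normal form. It is found by normalising subterms first; normalisation
is only weak, since a redex under a replication can be copied by `≡` without end. -/
theorem Proc.exists_etaNormal {k : ℕ} (P : Proc N k) :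
    ∃ Q, Relation.ReflTransGen EtaStep P Q ∧ Q.EtaNormal := by
  induction P with
  | nil => exact ⟨_, .refl, trivial⟩
  | par P Q ihP ihQ =>
    obtain ⟨P', hP, nP⟩ := ihP
    obtain ⟨Q', hQ, nQ⟩ := ihQ
    exact ⟨.par P' Q', (hP.lift (Proc.par · Q) fun _ _ => EtaStep.parLeft Q).trans
      (hQ.lift (Proc.par P' ·) fun _ _ => EtaStep.parRight P'), nP, nQ⟩
  | repl P ih =>
    obtain ⟨P', hP, nP⟩ := ih
    exact ⟨.repl P', hP.lift Proc.repl fun _ _ => EtaStep.repl, nP⟩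
  | pre c P ih =>
    obtain ⟨P', hP, nP⟩ := ih
    exact ⟨.pre c P', hP.lift (Proc.pre c) fun _ _ => EtaStep.pre c, nP⟩
  | amb η P ih =>
    obtain ⟨P', hP, nP⟩ := ih
    exact ⟨.amb η P', hP.lift (Proc.amb η) fun _ _ => EtaStep.amb η, nP⟩
  | msg η => exact ⟨_, .refl, trivial⟩
  | abs P ih =>
    obtain ⟨P', hP, nP⟩ := ih
    obtain ⟨R, hR, nR⟩ := Proc.exists_abs_etaNormal hP nP
    exact ⟨_, hR, nR⟩

theorem HasSd.eq_seqDeg {k : ℕ} {P : Proc N k} {a : ℕ} (h : HasSd P a) : a = P.seqDeg := by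
  induction h with
  | nil => rfl
  | par _ _ ih₁ ih₂ => rw [ih₁, ih₂, Proc.seqDeg]
  | amb η _ ih => exact ih
  | repl _ ih => exact ih
  | pre c _ ih => rw [ih, Proc.seqDeg]
  | msg η => rfl
  | @abs k P P' a hnf _ ih =>
    have inv : (Proc.abs P).seqDeg = (Proc.abs P').seqDeg := by
      have := hnf.1
      generalize Proc.abs P' = R at this
      induction this with
      | refl => rfl
      | tail _ h' ih' => exact ih'.trans h'.seqDeg_eq
    have hb : ¬ P'.IsEtaBody := fun hb => by
      obtain ⟨A, hA⟩ := hb.exists_eta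
      exact hnf.2 _ (.str (SC.abs hA) (.eta A) (.refl _))
    rw [inv, Proc.seqDeg, if_neg hb, ih]

theorem Proc.EtaNormal.exists_hasSd {k : ℕ} {P : Proc N k} (h : P.EtaNormal) :
    ∃ a, HasSd P a := by
  induction P with
  | nil => exact ⟨_, .nil⟩
  | par P Q ihP ihQ =>
    obtain ⟨a, ha⟩ := ihP h.1
    obtain ⟨b, hb⟩ := ihQ h.2
    exact ⟨_, .par ha hb⟩
  | repl P ih => exact (ih h).imp fun _ => .repl
  | pre c P ih =>
    obtain ⟨a, ha⟩ := ih h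
    exact ⟨_, .pre c ha⟩
  | amb η P ih => exact (ih h).imp fun _ => .amb η
  | msg η => exact ⟨_, .msg η⟩
  | abs P ih =>
    obtain ⟨a, ha⟩ := ih h.1
    exact ⟨_, .abs ⟨.refl, fun _ h' => h'.not_etaNormal h⟩ ha⟩

theorem Proc.exists_hasSd {k : ℕ} (P : Proc N k) : ∃ a, HasSd P a := by
  induction P with
  | nil => exact ⟨_, .nil⟩
  | par P Q ihP ihQ =>
    obtain ⟨a, ha⟩ := ihP
    obtain ⟨b, hb⟩ := ihQ
    exact ⟨_, .par ha hb⟩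
  | repl P ih => exact ih.imp fun _ => .repl
  | pre c P ih =>
    obtain ⟨a, ha⟩ := ih
    exact ⟨_, .pre c ha⟩
  | amb η P ih => exact ih.imp fun _ => .amb η
  | msg η => exact ⟨_, .msg η⟩
  | abs P ih =>
    obtain ⟨Q, hQ, nQ⟩ := P.exists_etaNormal
    obtain ⟨R, hR, nR⟩ := Proc.exists_abs_etaNormal hQ nQ
    obtain ⟨a, ha⟩ := nR.1.exists_hasSd
    exact ⟨_, .abs ⟨hR, fun _ h' => h'.not_etaNormal nR⟩ ha⟩

theorem Proc.sd_eq_seqDeg {k : ℕ} (P : Proc N k) : P.sd = P.seqDeg :=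
  HasSd.eq_seqDeg (Nat.sInf_mem P.exists_hasSd)

theorem ImmediateSubterm.sd_le {P Q : Σ k, Proc N k} (h : ImmediateSubterm P Q) :
    P.2.sd ≤ Q.2.sd := by
  rw [Proc.sd_eq_seqDeg, Proc.sd_eq_seqDeg]
  cases h with
  | parLeft P Q => exact le_max_left _ _
  | parRight P Q => exact le_max_right _ _
  | repl P => exact le_rfl
  | pre c P => exact Nat.le_add_left _ _
  | amb η P => exact le_rfl
  | abs P =>
    simp only [Proc.seqDeg]
    split_ifs
    · exact le_rfl
    · exact Nat.le_succ _

theorem ImmediateSubterm.sizeOf_lt {P Q : Σ k, Proc N k} (h : ImmediateSubterm P Q) :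
    sizeOf P.2 < sizeOf Q.2 := by
  cases h <;> simp; omega

theorem wellFounded_procLT : WellFounded (ProcLT (N := N)) := by
  refine Subrelation.wf (r := InvImage (Prod.Lex (· < ·) (· < ·))
    fun P : Σ k, Proc N k => (P.2.sd, sizeOf P.2)) ?_
    (InvImage.wf _ (WellFounded.prod_lex wellFounded_lt wellFounded_lt))
  intro P Q h
  rcases h with h | h
  · exact Prod.Lex.left _ _ h
  · have : P.2.sd ≤ Q.2.sd ∧ sizeOf P.2 < sizeOf Q.2 := by
      induction h with
      | single h => exact ⟨h.sd_le, h.sizeOf_lt⟩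
      | tail _ h ih => exact ⟨ih.1.trans h.sd_le, ih.2.trans h.sizeOf_lt⟩
    exact Prod.lex_iff.2 (this.1.lt_or_eq.imp id fun e => ⟨e, this.2⟩)

/-! ### Well-foundedness of the recursion -/

/-- The nesting depth of prefixes, all abstractions being counted. Unlike the sequentiality degree,
it decreases strictly from `(x)P` to `P{n/x}` for every `P`. -/
def Proc.depth : {k : ℕ} → Proc N k → ℕ
  | _, .nil => 0
  | _, .par P Q => max P.depth Q.depth
  | _, .repl P => P.depth
  | _, .pre _ P => P.depth + 1
  | _, .amb _ P => P.depth
  | _, .msg _ => 0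
  | _, .abs P => P.depth + 1

theorem SC.depth_eq {k : ℕ} {P Q : Proc N k} (h : SC P Q) : P.depth = Q.depth := by
  induction h with
  | refl P => rfl
  | symm _ ih => exact ih.symm
  | trans _ _ ih₁ ih₂ => exact ih₁.trans ih₂
  | par _ _ ih₁ ih₂ => simp only [Proc.depth, ih₁, ih₂]
  | repl _ ih => simpa only [Proc.depth] using ih
  | pre c _ ih => simp only [Proc.depth, ih]
  | amb η _ ih => simpa only [Proc.depth] using ih
  | abs h ih => simp only [Proc.depth, ih]
  | parNil P => simp [Proc.depth]
  | parComm P Q => exact max_comm _ _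
  | parAssoc P Q R => exact (max_assoc _ _ _).symm
  | replUnfold P => simp [Proc.depth]
  | replNil => rfl
  | replPar P Q => rfl
  | replRepl P => rfl

theorem Proc.depth_rename {k l : ℕ} (P : Proc N k) (f : Id N k → Id N l) :
    (P.rename f).depth = P.depth := by
  induction P generalizing l with
  | nil => rfl
  | par P Q ihP ihQ => simp only [Proc.rename, Proc.depth, ihP, ihQ]
  | repl P ih => simp only [Proc.rename, Proc.depth, ih]
  | pre c P ih => simp only [Proc.rename, Proc.depth, ih]
  | amb η P ih => simp only [Proc.rename, Proc.depth, ih]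
  | msg η => rfl
  | abs P ih => simp only [Proc.rename, Proc.depth, ih]

theorem Red.depth_le {P Q : Proc N 0} (h : Red P Q) : Q.depth ≤ P.depth := by
  induction h with
  | opening n P Q => simp only [Proc.depth]; omega
  | entering n m P₁ P₂ Q => simp only [Proc.depth]; omega
  | exiting n m P₁ P₂ Q => simp only [Proc.depth]; omega
  | com n P => simp only [Proc.depth, Proc.inst, Proc.depth_rename]; omega
  | par Q _ ih => simp only [Proc.depth]; omega
  | amb n _ ih => simpa only [Proc.depth] using ih
  | str h₁ _ h₂ ih => rw [h₁.depth_eq, ← h₂.depth_eq]; exact ih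

theorem Reds.depth_le {P Q : Proc N 0} (h : Reds P Q) : Q.depth ≤ P.depth := by
  induction h with
  | refl => exact le_rfl
  | tail _ h ih => exact h.depth_le.trans ih

theorem CapStep.depth_le {c : Cap (Id N 0)} {P Q : Proc N 0} (h : CapStep c P Q) :
    Q.depth ≤ P.depth := by
  obtain ⟨A, B, h, rfl⟩ := h
  rw [h.depth_eq]
  simp only [Proc.depth]
  omega

theorem Weak.depth_le {c : Cap (Id N 0)} {P Q : Proc N 0} (h : Weak (CapStep c) P Q) :
    Q.depth ≤ P.depth := by
  obtain ⟨A, B, h₁, h₂, h₃⟩ := h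
  exact h₃.depth_le.trans (h₂.depth_le.trans h₁.depth_le)

theorem Stutter.depth_le {c c' : Cap (Id N 0)} {P Q : Proc N 0} (h : Stutter c c' P Q) :
    Q.depth ≤ P.depth := by
  induction h with
  | refl => exact le_rfl
  | tail _ h ih =>
    obtain ⟨A, h₁, h₂⟩ := h
    exact h₂.depth_le.trans (h₁.depth_le.trans ih)

theorem Evolve.depth_le {c : Cap (Id N 0)} {P Q : Proc N 0} (h : Evolve c P Q) :
    Q.depth ≤ P.depth := by
  cases c with
  | enter n =>
    obtain ⟨A, h₁, h₂⟩ := h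
    exact h₂.depth_le.trans h₁.depth_le
  | exit n =>
    obtain ⟨A, h₁, h₂⟩ := h
    exact h₂.depth_le.trans h₁.depth_le
  | dissolve n => exact Reds.depth_le h

theorem Proc.depth_le_parList {k : ℕ} {P : Proc N k} {L : List (Proc N k)} (h : P ∈ L) :
    P.depth ≤ (Proc.parList L).depth := by
  induction L with
  | nil => simp at h
  | cons Q L ih =>
    rcases List.mem_cons.1 h with rfl | h
    · exact le_max_left _ _
    · exact (ih h).trans (le_max_right _ _)

/-- The order on pairs along which `∼ind` is defined: the sum of the depths decreases, or it does
not increase and the left-hand process gets smaller. -/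
def PairLT : Proc N 0 × Proc N 0 → Proc N 0 × Proc N 0 → Prop :=
  InvImage (Prod.Lex (· < ·) (· < ·)) fun p => (p.1.depth + p.2.depth, sizeOf p.1)

theorem wellFounded_pairLT : WellFounded (PairLT (N := N)) :=
  InvImage.wf _ (WellFounded.prod_lex wellFounded_lt wellFounded_lt)

theorem PairLT.of_depth_lt {P Q P' Q' : Proc N 0}
    (h : P'.depth + Q'.depth < P.depth + Q.depth) : PairLT (P', Q') (P, Q) :=
  Prod.Lex.left _ _ h

theorem PairLT.of_depth_le {P Q P' Q' : Proc N 0} (hP : P'.depth ≤ P.depth)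
    (hQ : Q'.depth ≤ Q.depth) (h : sizeOf P' < sizeOf P) : PairLT (P', Q') (P, Q) :=
  Prod.lex_iff.2 ((add_le_add hP hQ).lt_or_eq.imp id fun e => ⟨e, h⟩)

theorem IndClause.imp {R S : Proc N 0 → Proc N 0 → Prop} {P Q : Proc N 0}
    (H : ∀ P' Q', PairLT (P', Q') (P, Q) → R P' Q' → S P' Q') (h : IndClause R P Q) :
    IndClause S P Q := by
  cases P with
  | nil => exact h
  | amb n P =>
    obtain ⟨Q', hQ, h⟩ := h
    refine ⟨Q', hQ, H _ _ (.of_depth_le le_rfl hQ.depth_eq.ge ?_) h⟩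
    simp
  | par P₁ P₂ =>
    obtain ⟨Q₁, Q₂, hQ, h₁, h₂⟩ := h
    have e := hQ.depth_eq
    simp only [Proc.depth] at e
    refine ⟨Q₁, Q₂, hQ, H _ _ (.of_depth_le (le_max_left _ _) (by omega) ?_) h₁,
      H _ _ (.of_depth_le (le_max_right _ _) (by omega) ?_) h₂⟩
    · simp; omega
    · simp
  | repl P =>
    obtain ⟨L₁, L₂, hL, hQ, h₁, h₂⟩ := h
    have e := hQ.depth_eq
    simp only [Proc.depth] at e
    refine ⟨L₁, L₂, hL, hQ, fun Q' hQ' => H _ _ (.of_depth_le le_rfl ?_ ?_) (h₁ Q' hQ'),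
      fun Q' hQ' => H _ _ (.of_depth_le le_rfl ?_ ?_) (h₂ Q' hQ')⟩
    · have := Proc.depth_le_parList (List.mem_map_of_mem (f := Proc.repl) hQ')
      simp only [Proc.depth] at this
      omega
    · simp
    · have := Proc.depth_le_parList hQ'
      omega
    · simp
  | pre c P =>
    obtain ⟨Q', hQ, ⟨P'', hP, h₁⟩, Q'', hQ', h₂⟩ := h
    have e := hQ.depth_eq
    have e₁ := hP.depth_le
    have e₂ := hQ'.depth_le
    simp only [Proc.depth] at e
    refine ⟨Q', hQ, ⟨P'', hP, H _ _ (.of_depth_lt ?_) h₁⟩,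
      Q'', hQ', H _ _ (.of_depth_lt ?_) h₂⟩ <;> simp only [Proc.depth] <;> omega
  | msg n => exact h
  | abs P =>
    obtain ⟨Q', m, hm, hQ, ⟨Q'', hQ', h₁⟩, P'', hP, h₂⟩ := h
    have e := hQ.depth_eq
    have e₁ := hP.depth_le
    have e₂ := hQ'.depth_le
    simp only [Proc.depth] at e e₁ e₂
    refine ⟨Q', m, hm, hQ, ⟨Q'', hQ', H _ _ (.of_depth_lt ?_) h₁⟩,
      P'', hP, H _ _ (.of_depth_lt ?_) h₂⟩ <;>
      simp only [Proc.depth, Proc.inst, Proc.depth_rename] <;> omega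

theorem isWellFoundedRecursion_indClause : IsWellFoundedRecursion (IndClause (N := N)) :=
  ⟨PairLT, wellFounded_pairLT, fun _ _ _ _ H =>
    ⟨IndClause.imp fun P' Q' h => (H P' Q' h).1, IndClause.imp fun P' Q' h => (H P' Q' h).2⟩⟩

theorem IsWellFoundedRecursion.fixedPoint_unique {α : Type u} {F : (α → α → Prop) → α → α → Prop}
    (hF : IsWellFoundedRecursion F) {R S : α → α → Prop} (hR : ∀ P Q, R P Q ↔ F R P Q)
    (hS : ∀ P Q, S P Q ↔ F S P Q) (P Q : α) : R P Q ↔ S P Q := by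
  obtain ⟨lt, wf, h⟩ := hF
  suffices ∀ p : α × α, R p.1 p.2 ↔ S p.1 p.2 from this (P, Q)
  intro p
  induction p using wf.induction with
  | _ p ih => rw [hR, hS, h R S p.1 p.2 fun P' Q' h' => ih (P', Q') h']

/-! ### Reductions and transitions modulo structural congruence -/

/-- Reduction of classes of processes. -/
inductive QRed : PQ N 0 → PQ N 0 → Prop
  | opening (n : Id N 0) (x y : PQ N 0) : QRed (PQ.pre (.dissolve n) x + PQ.amb n y) (x + y)
  | entering (n m : Id N 0) (x₁ x₂ y : PQ N 0) :
      QRed (PQ.amb n (PQ.pre (.enter m) x₁ + x₂) + PQ.amb m y)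
        (PQ.amb m (PQ.amb n (x₁ + x₂) + y))
  | exiting (n m : Id N 0) (x₁ x₂ y : PQ N 0) :
      QRed (PQ.amb m (PQ.amb n (PQ.pre (.exit m) x₁ + x₂) + y))
        (PQ.amb n (x₁ + x₂) + PQ.amb m y)
  | com (n : Id N 0) (x : PQ N 1) : QRed (PQ.msg n + PQ.abs x) (PQ.inst x n)
  | par {x x' : PQ N 0} (z : PQ N 0) : QRed x x' → QRed (x + z) (x' + z)
  | amb (n : Id N 0) {x x' : PQ N 0} : QRed x x' → QRed (PQ.amb n x) (PQ.amb n x')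

/-- `⟹` on classes of processes. -/
def QReds : PQ N 0 → PQ N 0 → Prop := Relation.ReflTransGen QRed

/-- `—cap→` on classes of processes. -/
def QCapStep (c : Cap (Id N 0)) (x y : PQ N 0) : Prop :=
  ∃ a b, x = PQ.pre c a + b ∧ y = a + b

/-- `—⟨n⟩→` on classes of processes. -/
def QMsgStep (n : Id N 0) (x y : PQ N 0) : Prop := x = PQ.msg n + y

/-- The weak transition `⟹ —μ→ ⟹` on classes of processes. -/
def QWeak (step : PQ N 0 → PQ N 0 → Prop) (x y : PQ N 0) : Prop :=
  ∃ a b, QReds x a ∧ step a b ∧ QReds b y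

/-- Stuttering on classes of processes. -/
def QStutter (c₁ c₂ : Cap (Id N 0)) : PQ N 0 → PQ N 0 → Prop :=
  Relation.ReflTransGen fun x y => ∃ a, QWeak (QCapStep c₁) x a ∧ QWeak (QCapStep c₂) a y

/-- The relation `⇛cap` on classes of processes. -/
def QEvolve (c : Cap (Id N 0)) (x y : PQ N 0) : Prop :=
  match c with
  | .enter n => ∃ a, QReds x a ∧ QStutter (.exit n) (.enter n) a y
  | .exit n => ∃ a, QReds x a ∧ QStutter (.enter n) (.exit n) a y
  | .dissolve _ => QReds x y

/-- `T` is the relation on classes of processes induced by `S`, and every class related by `T` to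
the class of `P` contains a process related by `S` to `P` itself. -/
structure Induces (S : Proc N 0 → Proc N 0 → Prop) (T : PQ N 0 → PQ N 0 → Prop) : Prop where
  map : ∀ {P Q}, S P Q → T (PQ.mk P) (PQ.mk Q)
  lift : ∀ {P y}, T (PQ.mk P) y → ∃ Q, S P Q ∧ PQ.mk Q = y

theorem Induces.comp {S S' : Proc N 0 → Proc N 0 → Prop} {T T' : PQ N 0 → PQ N 0 → Prop}
    (h : Induces S T) (h' : Induces S' T') :
    Induces (fun P Q => ∃ A, S P A ∧ S' A Q) (fun x y => ∃ a, T x a ∧ T' a y) where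
  map := fun ⟨A, h₁, h₂⟩ => ⟨_, h.map h₁, h'.map h₂⟩
  lift := fun ⟨a, h₁, h₂⟩ => by
    obtain ⟨A, hA, rfl⟩ := h.lift h₁
    obtain ⟨Q, hQ, rfl⟩ := h'.lift h₂
    exact ⟨Q, ⟨A, hA, hQ⟩, rfl⟩

theorem Induces.reflTransGen {S : Proc N 0 → Proc N 0 → Prop} {T : PQ N 0 → PQ N 0 → Prop}
    (h : Induces S T) : Induces (Relation.ReflTransGen S) (Relation.ReflTransGen T) where
  map := fun h' => h'.lift PQ.mk fun _ _ => h.map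
  lift := fun h' => by
    induction h' with
    | refl => exact ⟨_, .refl, rfl⟩
    | tail _ h₂ ih =>
      obtain ⟨A, hA, rfl⟩ := ih
      obtain ⟨Q, hQ, rfl⟩ := h.lift h₂
      exact ⟨Q, hA.tail hQ, rfl⟩

theorem QRed.red {x y : PQ N 0} (h : QRed x y) {P Q : Proc N 0} (hP : PQ.mk P = x)
    (hQ : PQ.mk Q = y) : Red P Q := by
  induction h generalizing P Q with
  | opening n x y =>
    obtain ⟨A, rfl⟩ := PQ.exists_mk x
    obtain ⟨B, rfl⟩ := PQ.exists_mk y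
    exact .str (PQ.mk_eq_mk.1 hP) (.opening n A B) (PQ.mk_eq_mk.1 hQ.symm)
  | entering n m x₁ x₂ y =>
    obtain ⟨A₁, rfl⟩ := PQ.exists_mk x₁
    obtain ⟨A₂, rfl⟩ := PQ.exists_mk x₂
    obtain ⟨B, rfl⟩ := PQ.exists_mk y
    exact .str (PQ.mk_eq_mk.1 hP) (.entering n m A₁ A₂ B) (PQ.mk_eq_mk.1 hQ.symm)
  | exiting n m x₁ x₂ y =>
    obtain ⟨A₁, rfl⟩ := PQ.exists_mk x₁
    obtain ⟨A₂, rfl⟩ := PQ.exists_mk x₂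
    obtain ⟨B, rfl⟩ := PQ.exists_mk y
    exact .str (PQ.mk_eq_mk.1 hP) (.exiting n m A₁ A₂ B) (PQ.mk_eq_mk.1 hQ.symm)
  | com n x =>
    obtain ⟨A, rfl⟩ := PQ.exists_mk x
    exact .str (PQ.mk_eq_mk.1 hP) (.com n A) (PQ.mk_eq_mk.1 hQ.symm)
  | @par x x' z _ ih =>
    obtain ⟨A, hA⟩ := PQ.exists_mk x
    obtain ⟨A', hA'⟩ := PQ.exists_mk x'
    obtain ⟨B, rfl⟩ := PQ.exists_mk z
    refine .str (P' := .par A B) (P'' := .par A' B) (PQ.mk_eq_mk.1 ?_) (.par B (ih hA hA'))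
      (PQ.mk_eq_mk.1 ?_)
    · rw [hP, PQ.mk_par, hA]
    · rw [hQ, PQ.mk_par, hA']
  | @amb n x x' _ ih =>
    obtain ⟨A, hA⟩ := PQ.exists_mk x
    obtain ⟨A', hA'⟩ := PQ.exists_mk x'
    refine .str (P' := .amb n A) (P'' := .amb n A') (PQ.mk_eq_mk.1 ?_) (.amb n (ih hA hA'))
      (PQ.mk_eq_mk.1 ?_)
    · rw [hP, PQ.mk_amb, hA]
    · rw [hQ, PQ.mk_amb, hA']

theorem induces_red : Induces (Red (N := N)) QRed where
  map := fun h => by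
    induction h with
    | opening n P Q => exact .opening n (PQ.mk P) (PQ.mk Q)
    | entering n m P₁ P₂ Q => exact .entering n m (PQ.mk P₁) (PQ.mk P₂) (PQ.mk Q)
    | exiting n m P₁ P₂ Q => exact .exiting n m (PQ.mk P₁) (PQ.mk P₂) (PQ.mk Q)
    | com n P => exact .com n (PQ.mk P)
    | par Q _ ih => exact .par (PQ.mk Q) ih
    | amb n _ ih => exact .amb n ih
    | str h₁ _ h₂ ih => rwa [PQ.mk_eq_mk.2 h₁, ← PQ.mk_eq_mk.2 h₂]
  lift := fun {P y} h => by
    obtain ⟨Q, hQ⟩ := PQ.exists_mk y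
    exact ⟨Q, h.red rfl hQ, hQ⟩

theorem induces_reds : Induces (Reds (N := N)) QReds := induces_red.reflTransGen

theorem induces_capStep (c : Cap (Id N 0)) : Induces (CapStep c) (QCapStep c) where
  map := by
    rintro P Q ⟨A, B, h, rfl⟩
    exact ⟨PQ.mk A, PQ.mk B, PQ.mk_eq_mk.2 h, rfl⟩
  lift := by
    rintro P y ⟨a, b, h, rfl⟩
    obtain ⟨A, rfl⟩ := PQ.exists_mk a
    obtain ⟨B, rfl⟩ := PQ.exists_mk b
    exact ⟨.par A B, ⟨A, B, PQ.mk_eq_mk.1 h, rfl⟩, rfl⟩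

theorem induces_msgStep (n : Id N 0) : Induces (MsgStep n) (QMsgStep n) where
  map h := PQ.mk_eq_mk.2 h
  lift := by
    rintro P y h
    obtain ⟨Q, rfl⟩ := PQ.exists_mk y
    exact ⟨Q, PQ.mk_eq_mk.1 h, rfl⟩

theorem Induces.weak {S : Proc N 0 → Proc N 0 → Prop} {T : PQ N 0 → PQ N 0 → Prop}
    (h : Induces S T) : Induces (Weak S) (QWeak T) where
  map := fun ⟨_, _, h₁, h₂, h₃⟩ => ⟨_, _, induces_reds.map h₁, h.map h₂, induces_reds.map h₃⟩
  lift := fun ⟨a, b, h₁, h₂, h₃⟩ => by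
    obtain ⟨A, hA, rfl⟩ := induces_reds.lift h₁
    obtain ⟨B, hB, rfl⟩ := h.lift h₂
    obtain ⟨Q, hQ, rfl⟩ := induces_reds.lift h₃
    exact ⟨Q, ⟨A, B, hA, hB, hQ⟩, rfl⟩

theorem induces_stutter (c₁ c₂ : Cap (Id N 0)) : Induces (Stutter c₁ c₂) (QStutter c₁ c₂) :=
  ((induces_capStep c₁).weak.comp (induces_capStep c₂).weak).reflTransGen

theorem induces_evolve (c : Cap (Id N 0)) : Induces (Evolve c) (QEvolve c) := by
  cases c with
  | enter n => exact induces_reds.comp (induces_stutter _ _)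
  | exit n => exact induces_reds.comp (induces_stutter _ _)
  | dissolve n => exact induces_reds

theorem QReds.par {x x' : PQ N 0} (h : QReds x x') (z : PQ N 0) : QReds (x + z) (x' + z) :=
  h.lift (· + z) fun _ _ => QRed.par z

theorem QReds.amb {x x' : PQ N 0} (h : QReds x x') (n : Id N 0) :
    QReds (PQ.amb n x) (PQ.amb n x') :=
  h.lift (PQ.amb n) fun _ _ => QRed.amb n

theorem QWeak.par_cap {c : Cap (Id N 0)} {x y : PQ N 0} (h : QWeak (QCapStep c) x y)
    (z : PQ N 0) : QWeak (QCapStep c) (x + z) (y + z) := by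
  obtain ⟨_, _, h₁, ⟨a, b, rfl, rfl⟩, h₂⟩ := h
  exact ⟨_, _, h₁.par z, ⟨a, b + z, add_assoc _ _ _, rfl⟩, by simpa only [add_assoc] using h₂.par z⟩

theorem QWeak.par_msg {n : Id N 0} {x y : PQ N 0} (h : QWeak (QMsgStep n) x y)
    (z : PQ N 0) : QWeak (QMsgStep n) (x + z) (y + z) := by
  obtain ⟨_, b, h₁, rfl, h₂⟩ := h
  exact ⟨_, _, h₁.par z, add_assoc _ _ _, h₂.par z⟩

theorem QStutter.par {c₁ c₂ : Cap (Id N 0)} {x y : PQ N 0} (h : QStutter c₁ c₂ x y)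
    (z : PQ N 0) : QStutter c₁ c₂ (x + z) (y + z) :=
  h.lift (· + z) fun _ _ ⟨_, h₁, h₂⟩ => ⟨_, h₁.par_cap z, h₂.par_cap z⟩

theorem QEvolve.par {c : Cap (Id N 0)} {x y : PQ N 0} (h : QEvolve c x y)
    (z : PQ N 0) : QEvolve c (x + z) (y + z) := by
  cases c with
  | enter n => exact ⟨_, h.choose_spec.1.par z, h.choose_spec.2.par z⟩
  | exit n => exact ⟨_, h.choose_spec.1.par z, h.choose_spec.2.par z⟩
  | dissolve n => exact QReds.par h z

theorem QRed.rename {x y : PQ N 0} (h : QRed x y) (f : Id N 0 → Id N 0) :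
    QRed (PQ.rename f x) (PQ.rename f y) := by
  induction h with
  | opening n x y =>
    simp only [PQ.rename_add, PQ.rename_pre, PQ.rename_amb]
    exact .opening _ _ _
  | entering n m x₁ x₂ y =>
    simp only [PQ.rename_add, PQ.rename_pre, PQ.rename_amb]
    exact .entering _ _ _ _ _
  | exiting n m x₁ x₂ y =>
    simp only [PQ.rename_add, PQ.rename_pre, PQ.rename_amb]
    exact .exiting _ _ _ _ _
  | com n x =>
    rw [PQ.rename_add, PQ.rename_msg, PQ.rename_abs, PQ.rename_inst]
    exact .com _ _
  | par z _ ih =>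
    rw [PQ.rename_add, PQ.rename_add]
    exact .par _ ih
  | amb n _ ih =>
    rw [PQ.rename_amb, PQ.rename_amb]
    exact .amb _ ih

theorem QReds.rename {x y : PQ N 0} (h : QReds x y) (f : Id N 0 → Id N 0) :
    QReds (PQ.rename f x) (PQ.rename f y) :=
  h.lift (PQ.rename f) fun _ _ h => h.rename f

theorem QWeak.rename_cap {c : Cap (Id N 0)} {x y : PQ N 0} (h : QWeak (QCapStep c) x y)
    (f : Id N 0 → Id N 0) : QWeak (QCapStep (c.map f)) (PQ.rename f x) (PQ.rename f y) := by
  obtain ⟨_, _, h₁, ⟨a, b, rfl, rfl⟩, h₂⟩ := h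
  exact ⟨_, _, h₁.rename f, ⟨_, _, by rw [PQ.rename_add, PQ.rename_pre], PQ.rename_add _ _ _⟩,
    h₂.rename f⟩

theorem QWeak.rename_msg {n : Id N 0} {x y : PQ N 0} (h : QWeak (QMsgStep n) x y)
    (f : Id N 0 → Id N 0) : QWeak (QMsgStep (f n)) (PQ.rename f x) (PQ.rename f y) := by
  obtain ⟨_, _, h₁, rfl, h₂⟩ := h
  exact ⟨_, _, h₁.rename f, PQ.rename_add _ _ _, h₂.rename f⟩

theorem QStutter.rename {c₁ c₂ : Cap (Id N 0)} {x y : PQ N 0} (h : QStutter c₁ c₂ x y)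
    (f : Id N 0 → Id N 0) :
    QStutter (c₁.map f) (c₂.map f) (PQ.rename f x) (PQ.rename f y) :=
  h.lift (PQ.rename f) fun _ _ ⟨_, h₁, h₂⟩ => ⟨_, h₁.rename_cap f, h₂.rename_cap f⟩

theorem QEvolve.rename {c : Cap (Id N 0)} {x y : PQ N 0} (h : QEvolve c x y)
    (f : Id N 0 → Id N 0) : QEvolve (c.map f) (PQ.rename f x) (PQ.rename f y) := by
  cases c with
  | enter n => exact ⟨_, h.choose_spec.1.rename f, h.choose_spec.2.rename f⟩
  | exit n => exact ⟨_, h.choose_spec.1.rename f, h.choose_spec.2.rename f⟩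
  | dissolve n => exact QReds.rename h f

theorem QWeak.dissolve {n : Id N 0} {x y : PQ N 0} (h : QWeak (QCapStep (.dissolve n)) x y)
    (z : PQ N 0) : QReds (x + PQ.amb n z) (y + z) := by
  obtain ⟨_, _, h₁, ⟨a, b, rfl, rfl⟩, h₂⟩ := h
  refine ((h₁.par _).tail ?_).trans (h₂.par z)
  rw [add_right_comm, add_right_comm a]
  exact (QRed.opening n a z).par b

theorem QWeak.enter {m : Id N 0} {x y : PQ N 0} (h : QWeak (QCapStep (.enter m)) x y)
    (n : Id N 0) (z w : PQ N 0) :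
    QReds (PQ.amb n (x + z) + PQ.amb m w) (PQ.amb m (PQ.amb n (y + z) + w)) := by
  obtain ⟨_, _, h₁, ⟨a, b, rfl, rfl⟩, h₂⟩ := h
  refine ((((h₁.par z).amb n).par _).tail ?_).trans ((((h₂.par z).amb n).par w).amb m)
  rw [add_assoc, add_assoc]
  exact .entering n m a (b + z) w

theorem QWeak.exit {m : Id N 0} {x y : PQ N 0} (h : QWeak (QCapStep (.exit m)) x y)
    (n : Id N 0) (z w : PQ N 0) :
    QReds (PQ.amb m (PQ.amb n (x + z) + w)) (PQ.amb n (y + z) + PQ.amb m w) := by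
  obtain ⟨_, _, h₁, ⟨a, b, rfl, rfl⟩, h₂⟩ := h
  refine (((((h₁.par z).amb n).par w).amb m).tail ?_).trans (((h₂.par z).amb n).par _)
  rw [add_assoc, add_assoc]
  exact .exiting n m a (b + z) w

/-- Stuttering inside an ambient `n` located in an ambient `m` is a sequence of reductions, in which
`n` repeatedly leaves and enters `m`. -/
theorem QEvolve.enter {m : Id N 0} {x y : PQ N 0} (h : QEvolve (.enter m) x y)
    (n : Id N 0) (z w : PQ N 0) :
    QReds (PQ.amb m (PQ.amb n (x + z) + w)) (PQ.amb m (PQ.amb n (y + z) + w)) := by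
  obtain ⟨a, h₁, h₂⟩ := h
  refine ((((h₁.par z).amb n).par w).amb m).trans ?_
  induction h₂ with
  | refl => exact .refl
  | tail _ h ih =>
    obtain ⟨b, hb, hb'⟩ := h
    exact ih.trans ((hb.exit n z w).trans (hb'.enter n z w))

/-- Stuttering inside an ambient `n` next to an ambient `m` is a sequence of reductions, in which
`n` repeatedly enters and leaves `m`. -/
theorem QEvolve.exit {m : Id N 0} {x y : PQ N 0} (h : QEvolve (.exit m) x y)
    (n : Id N 0) (z w : PQ N 0) :
    QReds (PQ.amb n (x + z) + PQ.amb m w) (PQ.amb n (y + z) + PQ.amb m w) := by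
  obtain ⟨a, h₁, h₂⟩ := h
  refine (((h₁.par z).amb n).par _).trans ?_
  induction h₂ with
  | refl => exact .refl
  | tail _ h ih =>
    obtain ⟨b, hb, hb'⟩ := h
    exact ih.trans ((hb.enter n z w).trans (hb'.exit n z w))

/-! ### Bisimulations on classes of processes -/

/-- The clauses of intensional bisimulations on classes of processes, without the clause for
reductions, and with the clauses for transitions restricted to single guarded processes. -/
structure IsCore (r : PQ N 0 → PQ N 0 → Prop) : Prop where
  symm : ∀ {x y}, r x y → r y x
  zero : ∀ {y}, r 0 y → y = 0
  add : ∀ {x₁ x₂ y}, r (x₁ + x₂) y → ∃ y₁ y₂, y = y₁ + y₂ ∧ r x₁ y₁ ∧ r x₂ y₂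
  amb : ∀ {n x y}, r (PQ.amb n x) y → ∃ y', y = PQ.amb n y' ∧ r x y'
  cap : ∀ {c x y}, r (PQ.pre c x) y →
    ∃ a y', QWeak (QCapStep c) y a ∧ QEvolve c a y' ∧ r x y'
  msg : ∀ {n y}, r (PQ.msg n) y → ∃ y', QWeak (QMsgStep n) y y' ∧ r 0 y'
  input : ∀ {x y}, r (PQ.abs x) y → ∀ n, ∃ y', QReds (y + PQ.msg n) y' ∧ r (PQ.inst x n) y'

/-- The clause for reductions is a consequence of the others: the processes that take part in a
reduction are components, and intensionality gives matching components on the other side. -/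
theorem IsCore.tau {r : PQ N 0 → PQ N 0 → Prop} (hr : IsCore r)
    (hadd : ∀ {x x' y y'}, r x y → r x' y' → r (x + x') (y + y'))
    (hamb : ∀ {n x y}, r x y → r (PQ.amb n x) (PQ.amb n y)) {x x' y : PQ N 0} (h : QRed x x')
    (hxy : r x y) : ∃ y', QReds y y' ∧ r x' y' := by
  induction h generalizing y with
  | opening n x z =>
    obtain ⟨y₁, y₂, rfl, h₁, h₂⟩ := hr.add hxy
    obtain ⟨a, y₁', ha, ha', h₁'⟩ := hr.cap h₁
    obtain ⟨z', rfl, hz⟩ := hr.amb h₂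
    exact ⟨y₁' + z', (ha.dissolve z').trans (QReds.par ha' z'), hadd h₁' hz⟩
  | entering n m x₁ x₂ z =>
    obtain ⟨y₁, y₂, rfl, h₁, h₂⟩ := hr.add hxy
    obtain ⟨z', rfl, hz⟩ := hr.amb h₂
    obtain ⟨y₁', rfl, h₁'⟩ := hr.amb h₁
    obtain ⟨u, v, rfl, hu, hv⟩ := hr.add h₁'
    obtain ⟨a, u', ha, ha', hu'⟩ := hr.cap hu
    exact ⟨_, (ha.enter n v z').trans (ha'.enter n v z'), hamb (hadd (hamb (hadd hu' hv)) hz)⟩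
  | exiting n m x₁ x₂ z =>
    obtain ⟨y', rfl, h'⟩ := hr.amb hxy
    obtain ⟨y₁, z', rfl, h₁, hz⟩ := hr.add h'
    obtain ⟨y₁', rfl, h₁'⟩ := hr.amb h₁
    obtain ⟨u, v, rfl, hu, hv⟩ := hr.add h₁'
    obtain ⟨a, u', ha, ha', hu'⟩ := hr.cap hu
    exact ⟨_, (ha.exit n v z').trans (ha'.exit n v z'), hadd (hamb (hadd hu' hv)) (hamb hz)⟩
  | com n x =>
    obtain ⟨y₁, y₂, rfl, h₁, h₂⟩ := hr.add hxy
    obtain ⟨y₁', ⟨_, b, hb, rfl, hb'⟩, h₁'⟩ := hr.msg h₁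
    obtain ⟨y₂', hy, h₂'⟩ := hr.input h₂ n
    refine ⟨y₁' + y₂', ?_, by simpa using hadd h₁' h₂'⟩
    have h₃ := (hb'.par (y₂ + PQ.msg n)).trans (by
      simpa only [add_comm y₁'] using hy.par y₁' :
        QReds (y₁' + (y₂ + PQ.msg n)) (y₁' + y₂'))
    refine (hb.par y₂).trans ?_
    rwa [add_comm (PQ.msg n), add_assoc, add_comm (PQ.msg n)]
  | par z _ ih =>
    obtain ⟨y₁, y₂, rfl, h₁, h₂⟩ := hr.add hxy
    obtain ⟨y₁', h, h'⟩ := ih h₁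
    exact ⟨_, h.par y₂, hadd h' h₂⟩
  | amb n _ ih =>
    obtain ⟨y', rfl, h'⟩ := hr.amb hxy
    obtain ⟨y'', h, h''⟩ := ih h'
    exact ⟨_, h.amb n, hamb h''⟩

theorem IsCore.capStep {r : PQ N 0 → PQ N 0 → Prop} (hr : IsCore r)
    (hadd : ∀ {x x' y y'}, r x y → r x' y' → r (x + x') (y + y')) {c : Cap (Id N 0)}
    {P P' Q : Proc N 0} (h : r (PQ.mk P) (PQ.mk Q)) (hP : CapStep c P P') :
    ∃ A Q', Weak (CapStep c) Q A ∧ Evolve c A Q' ∧ r (PQ.mk P') (PQ.mk Q') := by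
  obtain ⟨P₁, P₂, hP, rfl⟩ := hP
  rw [PQ.mk_eq_mk.2 hP, PQ.mk_par, PQ.mk_pre] at h
  obtain ⟨y₁, y₂, e, h₁, h₂⟩ := hr.add h
  obtain ⟨a, y', ha, ha', h'⟩ := hr.cap h₁
  have hA := ha.par_cap y₂
  rw [← e] at hA
  obtain ⟨A, hA, hAa⟩ := (induces_capStep c).weak.lift hA
  have hQ := ha'.par y₂
  rw [← hAa] at hQ
  obtain ⟨Q', hQ, hQy⟩ := (induces_evolve c).lift hQ
  refine ⟨A, Q', hA, hQ, ?_⟩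
  rw [hQy, PQ.mk_par]
  exact hadd h' h₂

theorem Weak.trans_reds {step : Proc N 0 → Proc N 0 → Prop} {P Q R : Proc N 0}
    (h : Weak step P Q) (h' : Reds Q R) : Weak step P R := by
  obtain ⟨A, B, h₁, h₂, h₃⟩ := h
  exact ⟨A, B, h₁, h₂, h₃.trans h'⟩

theorem IsCore.isIntBisimulation {r : PQ N 0 → PQ N 0 → Prop} (hr : IsCore r)
    (hadd : ∀ {x x' y y'}, r x y → r x' y' → r (x + x') (y + y'))
    (hamb : ∀ {n x y}, r x y → r (PQ.amb n x) (PQ.amb n y)) :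
    IsIntBisimulation fun P Q => r (PQ.mk P) (PQ.mk Q) where
  symm := hr.symm
  par := fun {P Q} h P₁ P₂ hP => by
    rw [PQ.mk_eq_mk.2 hP, PQ.mk_par] at h
    obtain ⟨y₁, y₂, e, h₁, h₂⟩ := hr.add h
    obtain ⟨Q₁, rfl⟩ := PQ.exists_mk y₁
    obtain ⟨Q₂, rfl⟩ := PQ.exists_mk y₂
    exact ⟨Q₁, Q₂, PQ.mk_eq_mk.1 e, h₁, h₂⟩
  nil := fun {P Q} h hP => by
    rw [PQ.mk_eq_mk.2 hP] at h
    exact PQ.mk_eq_mk.1 (hr.zero h)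
  tau := fun {P Q} h P' hP => by
    obtain ⟨y', h₁, h₂⟩ := hr.tau hadd hamb (induces_red.map hP) h
    obtain ⟨Q', hQ, rfl⟩ := induces_reds.lift h₁
    exact ⟨Q', hQ, h₂⟩
  enter := fun {P Q} h n P' hP => by
    obtain ⟨A, Q', hA, ⟨B, hB, hB'⟩, h'⟩ := hr.capStep hadd h hP
    exact ⟨B, Q', hA.trans_reds hB, hB', h'⟩
  exit := fun {P Q} h n P' hP => by
    obtain ⟨A, Q', hA, ⟨B, hB, hB'⟩, h'⟩ := hr.capStep hadd h hP
    exact ⟨B, Q', hA.trans_reds hB, hB', h'⟩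
  dissolve := fun {P Q} h n P' hP => by
    obtain ⟨A, Q', hA, hB, h'⟩ := hr.capStep hadd h hP
    exact ⟨Q', hA.trans_reds hB, h'⟩
  msg := fun {P Q} h n P' hP => by
    rw [(induces_msgStep n).map hP] at h
    obtain ⟨y₁, y₂, e, h₁, h₂⟩ := hr.add h
    obtain ⟨y', hy, h'⟩ := hr.msg h₁
    have hy' := hy.par_msg y₂
    rw [← e] at hy'
    obtain ⟨Q', hQ, hQy⟩ := (induces_msgStep n).weak.lift hy'
    refine ⟨Q', hQ, ?_⟩
    rw [hQy]
    simpa using hadd h' h₂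
  input := fun {P Q} h n P' hP => by
    obtain ⟨P₁, P₂, hP, hP'⟩ := hP
    rw [PQ.mk_eq_mk.2 hP, PQ.mk_par, PQ.mk_abs] at h
    obtain ⟨y₁, y₂, e, h₁, h₂⟩ := hr.add h
    obtain ⟨y', hy, h'⟩ := hr.input h₁ n
    have hy' := hy.par y₂
    rw [add_right_comm, ← e] at hy'
    obtain ⟨Q', hQ, hQy⟩ := induces_reds.lift (P := .par Q (.msg n)) hy'
    refine ⟨Q', hQ, ?_⟩
    rw [hQy, PQ.mk_eq_mk.2 hP']
    exact hadd h' h₂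
  amb := fun {P Q} h n P' hP => by
    rw [PQ.mk_eq_mk.2 hP, PQ.mk_amb] at h
    obtain ⟨y', e, h'⟩ := hr.amb h
    obtain ⟨Q', rfl⟩ := PQ.exists_mk y'
    exact ⟨Q', PQ.mk_eq_mk.1 e, h'⟩

/-- Intensional bisimilarity on classes of processes. -/
def QBisim (x y : PQ N 0) : Prop := ∃ P Q, PQ.mk P = x ∧ PQ.mk Q = y ∧ IntBisim P Q

theorem isCore_qBisim : IsCore (QBisim (N := N)) where
  symm := fun ⟨P, Q, hP, hQ, R, hR, h⟩ => ⟨Q, P, hQ, hP, R, hR, hR.symm h⟩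
  zero := by
    rintro _ ⟨P, Q, hP, rfl, R, hR, h⟩
    exact PQ.mk_eq_mk.2 (hR.nil h (PQ.mk_eq_mk.1 hP))
  add := by
    rintro x₁ x₂ _ ⟨P, Q, hP, rfl, R, hR, h⟩
    obtain ⟨P₁, rfl⟩ := PQ.exists_mk x₁
    obtain ⟨P₂, rfl⟩ := PQ.exists_mk x₂
    obtain ⟨Q₁, Q₂, hQ, h₁, h₂⟩ := hR.par h P₁ P₂ (PQ.mk_eq_mk.1 hP)
    exact ⟨_, _, PQ.mk_eq_mk.2 hQ, ⟨_, _, rfl, rfl, R, hR, h₁⟩, ⟨_, _, rfl, rfl, R, hR, h₂⟩⟩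
  amb := by
    rintro n x _ ⟨P, Q, hP, rfl, R, hR, h⟩
    obtain ⟨P', rfl⟩ := PQ.exists_mk x
    obtain ⟨Q', hQ, h'⟩ := hR.amb h n P' (PQ.mk_eq_mk.1 hP)
    exact ⟨PQ.mk Q', PQ.mk_eq_mk.2 hQ, _, _, rfl, rfl, R, hR, h'⟩
  cap := by
    rintro c x _ ⟨P, Q, hP, rfl, R, hR, h⟩
    obtain ⟨P', rfl⟩ := PQ.exists_mk x
    have hP' : CapStep c P (.par P' .nil) :=
      ⟨P', .nil, PQ.mk_eq_mk.1 (hP.trans (add_zero _).symm), rfl⟩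
    have key : ∀ Q', R (.par P' .nil) Q' → QBisim (PQ.mk P') (PQ.mk Q') :=
      fun Q' h' => ⟨_, _, add_zero (PQ.mk P'), rfl, R, hR, h'⟩
    cases c with
    | enter n =>
      obtain ⟨A, Q', h₁, h₂, h'⟩ := hR.enter h n _ hP'
      exact ⟨_, _, (induces_capStep _).weak.map h₁, ⟨_, .refl, (induces_stutter _ _).map h₂⟩,
        key _ h'⟩
    | exit n =>
      obtain ⟨A, Q', h₁, h₂, h'⟩ := hR.exit h n _ hP'
      exact ⟨_, _, (induces_capStep _).weak.map h₁, ⟨_, .refl, (induces_stutter _ _).map h₂⟩,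
        key _ h'⟩
    | dissolve n =>
      obtain ⟨Q', h₁, h'⟩ := hR.dissolve h n _ hP'
      exact ⟨_, _, (induces_capStep _).weak.map h₁, Relation.ReflTransGen.refl, key _ h'⟩
  msg := by
    rintro n _ ⟨P, Q, hP, rfl, R, hR, h⟩
    obtain ⟨Q', h₁, h'⟩ := hR.msg h n .nil (PQ.mk_eq_mk.1 (hP.trans (add_zero _).symm))
    exact ⟨_, (induces_msgStep n).weak.map h₁, _, _, rfl, rfl, R, hR, h'⟩
  input := by
    rintro x _ ⟨P, Q, hP, rfl, R, hR, h⟩ n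
    obtain ⟨P', rfl⟩ := PQ.exists_mk x
    obtain ⟨Q', h₁, h'⟩ := hR.input h n (P'.inst n)
      ⟨P', .nil, PQ.mk_eq_mk.1 (hP.trans (add_zero _).symm), (SC.parNil _).symm⟩
    exact ⟨_, induces_reds.map h₁, _, _, rfl, rfl, R, hR, h'⟩

/-! ### Closure under contexts -/

/-- The closure of a relation under parallel composition and ambients; replication is applied to
related processes only once. -/
inductive CtxClosure (r : PQ N 0 → PQ N 0 → Prop) : PQ N 0 → PQ N 0 → Prop
  | base {x y : PQ N 0} : r x y → CtxClosure r x y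
  | zero : CtxClosure r 0 0
  | add {x x' y y' : PQ N 0} : CtxClosure r x y → CtxClosure r x' y' →
      CtxClosure r (x + x') (y + y')
  | amb (n : Id N 0) {x y : PQ N 0} : CtxClosure r x y → CtxClosure r (PQ.amb n x) (PQ.amb n y)
  | repl {x y : PQ N 0} : r x y → CtxClosure r (PQ.repl x) (PQ.repl y)

namespace IsCore

variable {r : PQ N 0 → PQ N 0 → Prop}

theorem ctxClosure_zero (hr : IsCore r) {x y : PQ N 0} (h : CtxClosure r x y) (hx : x = 0) :
    y = 0 := by
  induction h with
  | base h => exact hr.zero (hx ▸ h)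
  | zero => rfl
  | add _ _ ih₁ ih₂ =>
    rw [ih₁ (PQ.add_eq_zero_left hx), ih₂ (PQ.add_eq_zero_right hx), add_zero]
  | amb n _ _ => exact absurd hx (PQ.prime_ne_zero (.amb n _))
  | repl h =>
    rw [PQ.eq_zero_of_repl_eq_zero hx] at h
    rw [hr.zero h, PQ.repl_zero]

/-- A prime process is only related to another process by the closure because it was related to it
before, or because both are ambients with related contents. -/
theorem ctxClosure_prime (hr : IsCore r) {x y : PQ N 0} (h : CtxClosure r x y) {q : Prime N 0}
    (hx : x = q.toPQ) :
    r x y ∨ ∃ n x' y', x = PQ.amb n x' ∧ y = PQ.amb n y' ∧ CtxClosure r x' y' := by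
  induction h with
  | base h => exact .inl h
  | zero => exact absurd hx.symm (PQ.prime_ne_zero q)
  | add h₁ h₂ ih₁ ih₂ =>
    rcases PQ.prime_eq_add hx.symm with ⟨h0, hq⟩ | ⟨hq, h0⟩
    · rw [hr.ctxClosure_zero h₁ h0, h0, zero_add, zero_add]
      exact ih₂ hq
    · rw [hr.ctxClosure_zero h₂ h0, h0, add_zero, add_zero]
      exact ih₁ hq
  | amb n h _ => exact .inr ⟨n, _, _, rfl, rfl, h⟩
  | repl _ => exact absurd hx (PQ.repl_ne_prime _ q)

theorem ctxClosure_guard (hr : IsCore r) {x y : PQ N 0} (h : CtxClosure r x y) {q : Prime N 0}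
    (hx : x = q.toPQ) (hq : ∀ n x', q ≠ .amb n x') : r x y := by
  rcases hr.ctxClosure_prime h hx with h | ⟨n, x', y', e, -⟩
  · exact h
  · exact absurd (Prime.toPQ_injective (hx.symm.trans e : q.toPQ = (Prime.amb n x').toPQ)) (hq _ _)

theorem ctxClosure_copies {x y : PQ N 0} (h : r x y) (i : ℕ∞) :
    CtxClosure r (PQ.copies x i) (PQ.copies y i) := by
  induction i using ENat.recTopCoe with
  | top => exact .repl h
  | coe i =>
    rw [PQ.copies_coe, PQ.copies_coe]
    induction i with
    | zero => simpa using CtxClosure.zero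
    | succ i ih =>
      rw [succ_nsmul, succ_nsmul]
      exact .add ih (.base h)

theorem ctxClosure_repl_add (hr : IsCore r) {x y a b : PQ N 0} (h : r x y)
    (hab : PQ.repl x = a + b) :
    ∃ a' b', PQ.repl y = a' + b' ∧ CtxClosure r a a' ∧ CtxClosure r b b' := by
  induction x using PQ.induction_prime generalizing y a b with
  | zero =>
    rw [PQ.repl_zero] at hab
    rw [hr.zero h, PQ.repl_zero, PQ.add_eq_zero_left hab.symm, PQ.add_eq_zero_right hab.symm]
    exact ⟨0, 0, (add_zero 0).symm, .zero, .zero⟩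
  | add x₁ x₂ ih₁ ih₂ =>
    obtain ⟨y₁, y₂, rfl, h₁, h₂⟩ := hr.add h
    rw [PQ.repl_add] at hab
    obtain ⟨u, v, w, t, e₁, e₂, rfl, rfl⟩ := PQ.exists_refinement hab
    obtain ⟨u', v', e₁', hu, hv⟩ := ih₁ h₁ e₁
    obtain ⟨w', t', e₂', hw, ht⟩ := ih₂ h₂ e₂
    refine ⟨u' + w', v' + t', ?_, .add hu hw, .add hv ht⟩
    rw [PQ.repl_add, e₁', e₂']
    abel
  | prime q =>
    obtain ⟨i, j, rfl, rfl, e⟩ := PQ.copies_eq_add (n := ⊤) hab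
    refine ⟨PQ.copies y i, PQ.copies y j, ?_, ctxClosure_copies h i, ctxClosure_copies h j⟩
    rw [← PQ.copies_top, ← e]
    exact map_add (PQ.copiesHom y) i j
  | repl q =>
    rw [PQ.repl_repl] at hab
    have h' := h
    rw [hab] at h'
    obtain ⟨a₁, b₁, rfl, ha, hb⟩ := hr.add h'
    -- one of the two parts is `!q` itself, and is matched together with `!y`
    have big : ∀ {c d}, c = PQ.repl q.toPQ → r c d → CtxClosure r c (d + PQ.repl (a₁ + b₁)) := by
      intro c d hc hd
      have := CtxClosure.add (.base hd) (CtxClosure.repl h)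
      rwa [hc, PQ.repl_repl, PQ.repl_add_repl, ← hc] at this
    obtain ⟨i, j, hi, hj, e⟩ := PQ.copies_eq_add (n := ⊤) hab
    rcases (ENat.add_eq_top.1 e : i = ⊤ ∨ j = ⊤) with rfl | rfl
    · refine ⟨_, b₁, ?_, big hi ha, .base hb⟩
      rw [add_right_comm, add_comm (a₁ + b₁), PQ.repl_add_self]
    · refine ⟨a₁, _, ?_, .base ha, big hj hb⟩
      rw [← add_assoc, add_comm (a₁ + b₁), PQ.repl_add_self]

theorem ctxClosure (hr : IsCore r) : IsCore (CtxClosure r) where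
  symm := fun h => by
    induction h with
    | base h => exact .base (hr.symm h)
    | zero => exact .zero
    | add _ _ ih₁ ih₂ => exact .add ih₁ ih₂
    | amb n _ ih => exact .amb n ih
    | repl h => exact .repl (hr.symm h)
  zero := fun h => hr.ctxClosure_zero h rfl
  add := fun {x₁ x₂ y} h => by
    generalize e : x₁ + x₂ = x at h
    induction h generalizing x₁ x₂ with
    | base h =>
      subst e
      obtain ⟨y₁, y₂, e', h₁, h₂⟩ := hr.add h
      exact ⟨y₁, y₂, e', .base h₁, .base h₂⟩
    | zero =>
      rw [PQ.add_eq_zero_left e, PQ.add_eq_zero_right e]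
      exact ⟨0, 0, (add_zero 0).symm, .zero, .zero⟩
    | add _ _ ih₁ ih₂ =>
      obtain ⟨u, v, w, t, rfl, rfl, e₁, e₂⟩ := PQ.exists_refinement e
      obtain ⟨u', w', rfl, hu, hw⟩ := ih₁ e₁.symm
      obtain ⟨v', t', rfl, hv, ht⟩ := ih₂ e₂.symm
      exact ⟨u' + v', w' + t', by abel, .add hu hv, .add hw ht⟩
    | @amb n x y h _ =>
      rcases PQ.prime_eq_add (q := .amb n x) e.symm with ⟨rfl, rfl⟩ | ⟨rfl, rfl⟩
      · exact ⟨0, _, (zero_add _).symm, .zero, .amb n h⟩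
      · exact ⟨_, 0, (add_zero _).symm, .amb n h, .zero⟩
    | repl h => exact hr.ctxClosure_repl_add h e.symm
  amb := fun {n x y} h => by
    rcases hr.ctxClosure_prime h (q := .amb n x) rfl with h | ⟨m, x', y', e, rfl, h⟩
    · obtain ⟨y', e, h'⟩ := hr.amb h
      exact ⟨y', e, .base h'⟩
    · have := Prime.toPQ_injective (a₁ := .amb n x) (a₂ := .amb m x') e
      injection this with hn hx
      subst hn hx
      exact ⟨y', rfl, h⟩
  cap := fun {c x y} h => by
    obtain ⟨a, y', h₁, h₂, h'⟩ := hr.cap (hr.ctxClosure_guard h (q := .pre c x) rfl (by simp))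
    exact ⟨a, y', h₁, h₂, .base h'⟩
  msg := fun {n y} h => by
    obtain ⟨y', h₁, h'⟩ := hr.msg (hr.ctxClosure_guard h (q := .msg n) rfl (by simp))
    exact ⟨y', h₁, .base h'⟩
  input := fun {x y} h n => by
    obtain ⟨y', h₁, h'⟩ := hr.input (hr.ctxClosure_guard h (q := .abs x) rfl (by simp)) n
    exact ⟨y', h₁, .base h'⟩

/-- Coinduction up to contexts. -/
theorem ctxClosure_le_qBisim (hr : IsCore r) {x y : PQ N 0} (h : CtxClosure r x y) :
    QBisim x y := by
  obtain ⟨P, rfl⟩ := PQ.exists_mk x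
  obtain ⟨Q, rfl⟩ := PQ.exists_mk y
  exact ⟨P, Q, rfl, rfl, _, hr.ctxClosure.isIntBisimulation .add (.amb _), h⟩

end IsCore

theorem QBisim.add {x x' y y' : PQ N 0} (h : QBisim x y) (h' : QBisim x' y') :
    QBisim (x + x') (y + y') :=
  isCore_qBisim.ctxClosure_le_qBisim (.add (.base h) (.base h'))

theorem QBisim.amb {n : Id N 0} {x y : PQ N 0} (h : QBisim x y) :
    QBisim (PQ.amb n x) (PQ.amb n y) :=
  isCore_qBisim.ctxClosure_le_qBisim (.amb n (.base h))

theorem QBisim.repl {x y : PQ N 0} (h : QBisim x y) : QBisim (PQ.repl x) (PQ.repl y) :=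
  isCore_qBisim.ctxClosure_le_qBisim (.repl h)

theorem intBisim_iff_qBisim {P Q : Proc N 0} : IntBisim P Q ↔ QBisim (PQ.mk P) (PQ.mk Q) :=
  ⟨fun h => ⟨P, Q, rfl, rfl, h⟩,
    fun h => ⟨_, isCore_qBisim.isIntBisimulation QBisim.add QBisim.amb, h⟩⟩

/-! ### Closure under substitution of names -/

/-- The closure of a relation under renaming, where names may be identified. -/
def RenClosure (r : PQ N 0 → PQ N 0 → Prop) (x y : PQ N 0) : Prop :=
  ∃ (f : Id N 0 → Id N 0) (x₀ y₀ : PQ N 0), r x₀ y₀ ∧ PQ.rename f x₀ = x ∧ PQ.rename f y₀ = y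

theorem IsCore.renClosure [Infinite N] {r : PQ N 0 → PQ N 0 → Prop} (hr : IsCore r) :
    IsCore (RenClosure r) where
  symm := fun ⟨f, x₀, y₀, h, hx, hy⟩ => ⟨f, y₀, x₀, hr.symm h, hy, hx⟩
  zero := by
    rintro _ ⟨f, x₀, y₀, h, hx, rfl⟩
    rw [PQ.eq_zero_of_rename_eq_zero hx] at h
    rw [hr.zero h, PQ.rename_zero]
  add := by
    rintro x₁ x₂ _ ⟨f, x₀, y₀, h, hx, rfl⟩
    obtain ⟨u, v, rfl, rfl, rfl⟩ := PQ.exists_of_rename_eq_add hx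
    obtain ⟨y₁, y₂, rfl, h₁, h₂⟩ := hr.add h
    exact ⟨_, _, PQ.rename_add _ _ _, ⟨f, _, _, h₁, rfl, rfl⟩, ⟨f, _, _, h₂, rfl, rfl⟩⟩
  amb := by
    rintro n x _ ⟨f, x₀, y₀, h, hx, rfl⟩
    obtain ⟨p, rfl, hp⟩ := PQ.exists_of_rename_eq_prime (q := .amb n x) hx
    cases p with
    | amb m x₁ =>
      injection hp with hn hx'
      subst hn hx'
      obtain ⟨y', rfl, h'⟩ := hr.amb h
      exact ⟨_, PQ.rename_amb _ _ _, f, _, _, h', rfl, rfl⟩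
    | _ => cases hp
  cap := by
    rintro c x _ ⟨f, x₀, y₀, h, hx, rfl⟩
    obtain ⟨p, rfl, hp⟩ := PQ.exists_of_rename_eq_prime (q := .pre c x) hx
    cases p with
    | pre d x₁ =>
      injection hp with hc hx'
      subst hc hx'
      obtain ⟨a, y', h₁, h₂, h'⟩ := hr.cap h
      exact ⟨_, _, h₁.rename_cap f, h₂.rename f, f, _, _, h', rfl, rfl⟩
    | _ => cases hp
  msg := by
    rintro n _ ⟨f, x₀, y₀, h, hx, rfl⟩
    obtain ⟨p, rfl, hp⟩ := PQ.exists_of_rename_eq_prime (q := .msg n) hx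
    cases p with
    | msg m =>
      injection hp with hn
      subst hn
      obtain ⟨y', h₁, h'⟩ := hr.msg h
      exact ⟨_, h₁.rename_msg f, f, _, _, h', PQ.rename_zero f, rfl⟩
    | _ => cases hp
  input := by
    rintro x _ ⟨f, x₀, y₀, h, hx, rfl⟩ n
    obtain ⟨p, rfl, hp⟩ := PQ.exists_of_rename_eq_prime (q := .abs x) hx
    cases p with
    | abs x₁ =>
      injection hp with hx
      subst hx
      obtain ⟨X, rfl⟩ := PQ.exists_mk x₁
      obtain ⟨Y, rfl⟩ := PQ.exists_mk y₀
      -- the received name `n` need not be in the range of `f`: a fresh name `m` is received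
      -- instead, and is sent to `n` by a modification of `f`
      obtain ⟨m, hm⟩ := ((Proc.abs X).ids_finite.union Y.ids_finite).exists_notMem
      classical
      have hf : ∀ s : Set (Id N 0), m ∉ s → Set.EqOn (Function.update f m n) f s :=
        fun s hs η hη => Function.update_of_ne (ne_of_mem_of_not_mem hη hs) _ _
      have hX : PQ.rename (Id.lift (Function.update f m n)) (PQ.mk X) =
          PQ.rename (Id.lift f) (PQ.mk X) := congrArg PQ.mk
        (Proc.rename_congr (Id.lift_eqOn (hf (Proc.abs X).ids fun h => hm (.inl h))))
      have hY : PQ.rename (Function.update f m n) (PQ.mk Y) = PQ.rename f (PQ.mk Y) :=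
        congrArg PQ.mk (Proc.rename_congr (hf _ fun h => hm (.inr h)))
      obtain ⟨y', h₁, h'⟩ := hr.input h m
      have h₂ := h₁.rename (Function.update f m n)
      rw [PQ.rename_add, hY, PQ.rename_msg, Function.update_self] at h₂
      refine ⟨_, h₂, _, _, _, h', ?_, rfl⟩
      rw [PQ.rename_inst, hX, Function.update_self]
    | _ => cases hp

theorem QBisim.rename [Infinite N] {x y : PQ N 0} (h : QBisim x y) (f : Id N 0 → Id N 0) :
    QBisim (PQ.rename f x) (PQ.rename f y) :=
  isCore_qBisim.renClosure.ctxClosure_le_qBisim (.base ⟨f, x, y, h, rfl, rfl⟩)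

/-! ### Bisimilarity of guarded processes -/

theorem QWeak.pre (c : Cap (Id N 0)) (x : PQ N 0) : QWeak (QCapStep c) (PQ.pre c x) x :=
  ⟨_, _, .refl, ⟨x, 0, (add_zero _).symm, (add_zero _).symm⟩, .refl⟩

theorem QWeak.msg (n : Id N 0) : QWeak (QMsgStep n) (PQ.msg n) 0 :=
  ⟨_, _, .refl, (add_zero _).symm, .refl⟩

theorem QEvolve.refl (c : Cap (Id N 0)) (x : PQ N 0) : QEvolve c x x := by
  cases c with
  | enter n => exact ⟨x, .refl, .refl⟩
  | exit n => exact ⟨x, .refl, .refl⟩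
  | dissolve n => exact Relation.ReflTransGen.refl

theorem QEvolve.head {c : Cap (Id N 0)} {x y z : PQ N 0} (h : QReds x y) (h' : QEvolve c y z) :
    QEvolve c x z := by
  cases c with
  | enter n => exact ⟨_, h.trans h'.choose_spec.1, h'.choose_spec.2⟩
  | exit n => exact ⟨_, h.trans h'.choose_spec.1, h'.choose_spec.2⟩
  | dissolve n => exact Relation.ReflTransGen.trans h h'

theorem isCore_eq : IsCore (Eq : PQ N 0 → PQ N 0 → Prop) where
  symm := Eq.symm
  zero := Eq.symm
  add := by rintro x₁ x₂ _ rfl; exact ⟨_, _, rfl, rfl, rfl⟩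
  amb := by rintro n x _ rfl; exact ⟨_, rfl, rfl⟩
  cap := by rintro c x _ rfl; exact ⟨x, x, .pre c x, .refl c x, rfl⟩
  msg := by rintro n _ rfl; exact ⟨_, .msg n, rfl⟩
  input := by
    rintro x _ rfl n
    refine ⟨_, .single ?_, rfl⟩
    rw [add_comm]
    exact .com n x

theorem QBisim.refl (x : PQ N 0) : QBisim x x := isCore_eq.ctxClosure_le_qBisim (.base rfl)

/-- The prime `p` is not an ambient, and the transitions of `p` are matched by `y` up to
bisimilarity. -/
structure GuardSim (p : Prime N 0) (y : PQ N 0) : Prop where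
  amb : ∀ n x, p ≠ .amb n x
  cap : ∀ c x, p = .pre c x → ∃ a y', QWeak (QCapStep c) y a ∧ QEvolve c a y' ∧ QBisim x y'
  msg : ∀ n, p = .msg n → ∃ y', QWeak (QMsgStep n) y y' ∧ QBisim 0 y'
  input : ∀ x, p = .abs x → ∀ n, ∃ y', QReds (y + PQ.msg n) y' ∧ QBisim (PQ.inst x n) y'

theorem QBisim.of_guardSim {p q : Prime N 0} (hpq : GuardSim p q.toPQ) (hqp : GuardSim q p.toPQ) :
    QBisim p.toPQ q.toPQ := by
  let r : PQ N 0 → PQ N 0 → Prop := fun x y =>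
    QBisim x y ∨ ∃ p q : Prime N 0, GuardSim p q.toPQ ∧ GuardSim q p.toPQ ∧
      x = p.toPQ ∧ y = q.toPQ
  suffices hr : IsCore r from
    hr.ctxClosure_le_qBisim (.base (.inr ⟨p, q, hpq, hqp, rfl, rfl⟩))
  have core := isCore_qBisim (N := N)
  clear hpq hqp p q
  constructor
  · rintro x y (h | ⟨p, q, hpq, hqp, rfl, rfl⟩)
    · exact .inl (core.symm h)
    · exact .inr ⟨q, p, hqp, hpq, rfl, rfl⟩
  · rintro y (h | ⟨p, q, hpq, hqp, e, rfl⟩)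
    · exact core.zero h
    · exact absurd e.symm (PQ.prime_ne_zero p)
  · rintro x₁ x₂ y (h | ⟨p, q, hpq, hqp, e, rfl⟩)
    · obtain ⟨y₁, y₂, e, h₁, h₂⟩ := core.add h
      exact ⟨y₁, y₂, e, .inl h₁, .inl h₂⟩
    · rcases PQ.prime_eq_add e.symm with ⟨rfl, h⟩ | ⟨h, rfl⟩
      · exact ⟨0, _, (zero_add _).symm, .inl (.refl 0), .inr ⟨p, q, hpq, hqp, h, rfl⟩⟩
      · exact ⟨_, 0, (add_zero _).symm, .inr ⟨p, q, hpq, hqp, h, rfl⟩, .inl (.refl 0)⟩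
  · rintro n x y (h | ⟨p, q, hpq, hqp, e, rfl⟩)
    · obtain ⟨y', e, h⟩ := core.amb h
      exact ⟨y', e, .inl h⟩
    · exact absurd (Prime.toPQ_injective (a₁ := .amb n x) e).symm (hpq.amb n x)
  · rintro c x y (h | ⟨p, q, hpq, hqp, e, rfl⟩)
    · obtain ⟨a, y', h₁, h₂, h⟩ := core.cap h
      exact ⟨a, y', h₁, h₂, .inl h⟩
    · obtain ⟨a, y', h₁, h₂, h⟩ := hpq.cap c x (Prime.toPQ_injective (a₁ := .pre c x) e).symm
      exact ⟨a, y', h₁, h₂, .inl h⟩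
  · rintro n y (h | ⟨p, q, hpq, hqp, e, rfl⟩)
    · obtain ⟨y', h₁, h⟩ := core.msg h
      exact ⟨y', h₁, .inl h⟩
    · obtain ⟨y', h₁, h⟩ := hpq.msg n (Prime.toPQ_injective (a₁ := .msg n) e).symm
      exact ⟨y', h₁, .inl h⟩
  · rintro x y (h | ⟨p, q, hpq, hqp, e, rfl⟩) n
    · obtain ⟨y', h₁, h⟩ := core.input h n
      exact ⟨y', h₁, .inl h⟩
    · obtain ⟨y', h₁, h⟩ := hpq.input x (Prime.toPQ_injective (a₁ := .abs x) e).symm n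
      exact ⟨y', h₁, .inl h⟩

theorem QBisim.pre {c : Cap (Id N 0)} {x x' y y' : PQ N 0} (hx : QEvolve c x x')
    (hxy : QBisim x' y) (hy : QEvolve c y y') (hyx : QBisim y' x) :
    QBisim (PQ.pre c x) (PQ.pre c y) := by
  have key : ∀ {x y y' : PQ N 0}, QEvolve c y y' → QBisim y' x →
      GuardSim (.pre c x) (PQ.pre c y) := fun {x y y'} hy hyx =>
    { amb := by simp
      cap := fun d z e => by
        cases e
        exact ⟨_, _, .pre c y, hy, isCore_qBisim.symm hyx⟩
      msg := by simp
      input := by simp }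
  exact QBisim.of_guardSim (p := .pre c x) (q := .pre c y) (key hy hyx) (key hx hxy)

theorem QBisim.abs {x y : PQ N 1}
    (hx : ∀ n, ∃ z, QReds (PQ.abs y + PQ.msg n) z ∧ QBisim (PQ.inst x n) z)
    (hy : ∀ n, ∃ z, QReds (PQ.abs x + PQ.msg n) z ∧ QBisim (PQ.inst y n) z) :
    QBisim (PQ.abs x) (PQ.abs y) := by
  have key : ∀ {x y : PQ N 1},
      (∀ n, ∃ z, QReds (PQ.abs y + PQ.msg n) z ∧ QBisim (PQ.inst x n) z) →
      GuardSim (.abs x) (PQ.abs y) := fun {x y} hx =>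
    { amb := by simp
      cap := by simp
      msg := by simp
      input := fun z e => by
        cases e
        exact hx }
  exact QBisim.of_guardSim (p := .abs x) (q := .abs y) (key hx) (key hy)

/-- For fresh names, one instance of the clause for inputs gives all of them. -/
theorem QBisim.exists_input [Infinite N] {X : Proc N 1} {Y Z : Proc N 0} {m : N} (hX : m ∉ X.fn)
    (hY : m ∉ Y.fn) (h : Reds (.par Y (.msg (.inl m))) Z)
    (hZ : QBisim (PQ.mk Z) (PQ.mk (X.inst (.inl m)))) (n : Id N 0) :
    ∃ z, QReds (PQ.mk Y + PQ.msg n) z ∧ QBisim (PQ.inst (PQ.mk X) n) z := by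
  classical
  let f : Id N 0 → Id N 0 := Function.update id (.inl m) n
  have hf : ∀ s : Set (Id N 0), .inl m ∉ s → Set.EqOn f id s :=
    fun s hs η hη => Function.update_of_ne (ne_of_mem_of_not_mem hη hs) _ _
  have eX : PQ.rename (Id.lift f) (PQ.mk X) = PQ.mk X := by
    rw [← PQ.mk_rename, Proc.rename_congr (Id.lift_eqOn (hf (Proc.abs X).ids ?_)), Id.lift_id,
      Proc.rename_id]
    exact fun h => hX (Proc.inl_mem_ids.1 h)
  have eY : PQ.rename f (PQ.mk Y) = PQ.mk Y := by
    rw [← PQ.mk_rename, Proc.rename_congr (hf Y.ids ?_), Proc.rename_id]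
    exact fun h => hY (Proc.inl_mem_ids.1 h)
  have hm : f (.inl m) = n := Function.update_self _ _ _
  have h₁ := (induces_reds.map h).rename f
  rw [PQ.mk_par, PQ.rename_add, eY, PQ.mk_msg, PQ.rename_msg, hm] at h₁
  have h₂ := hZ.rename f
  rw [PQ.mk_inst, PQ.rename_inst, eX, hm] at h₂
  exact ⟨_, h₁, isCore_qBisim.symm h₂⟩

theorem QRed.exists_component {x y : PQ N 0} (h : QRed x y) :
    (∃ n a b, x = PQ.amb n a + b) ∨ ∃ n a b, x = PQ.msg n + (PQ.abs a + b) := by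
  induction h with
  | opening n x y => exact .inl ⟨n, y, _, add_comm _ _⟩
  | entering n m x₁ x₂ y => exact .inl ⟨n, _, _, rfl⟩
  | exiting n m x₁ x₂ y => exact .inl ⟨m, _, 0, (add_zero _).symm⟩
  | com n x => exact .inr ⟨n, x, 0, by rw [add_zero]⟩
  | par z _ ih =>
    rcases ih with ⟨n, a, b, rfl⟩ | ⟨n, a, b, rfl⟩
    · exact .inl ⟨n, a, b + z, add_assoc _ _ _⟩
    · exact .inr ⟨n, a, b + z, by simp only [add_assoc]⟩
  | amb n _ _ => exact .inl ⟨n, _, 0, (add_zero _).symm⟩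

theorem Prime.eq_of_toPQ_eq_add {p q : Prime N 0} {x : PQ N 0} (h : p.toPQ = q.toPQ + x) :
    p = q ∧ x = 0 := by
  rcases PQ.prime_eq_add h with ⟨h, -⟩ | ⟨h, h'⟩
  · exact absurd h (PQ.prime_ne_zero q)
  · exact ⟨(Prime.toPQ_injective h).symm, h'⟩

/-- A prime process that is not an ambient does not reduce. -/
theorem QReds.eq_of_prime {p : Prime N 0} (hp : ∀ n x, p ≠ .amb n x) {y : PQ N 0}
    (h : QReds p.toPQ y) : y = p.toPQ := by
  rcases h.cases_head with h | ⟨z, h, -⟩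
  · exact h.symm
  · rcases h.exists_component with ⟨n, a, b, e⟩ | ⟨n, a, b, e⟩
    · exact absurd (Prime.eq_of_toPQ_eq_add (q := .amb n a) e).1 (hp n a)
    · exact absurd (PQ.add_eq_zero_left (Prime.eq_of_toPQ_eq_add (q := .msg n) e).2)
        (PQ.prime_ne_zero (.abs a))

theorem QWeak.eq_pre_of_prime {p : Prime N 0} (hp : ∀ n x, p ≠ .amb n x) {c : Cap (Id N 0)}
    {y : PQ N 0} (h : QWeak (QCapStep c) p.toPQ y) : ∃ x, p = .pre c x ∧ QReds x y := by
  obtain ⟨_, _, h₁, ⟨a, b, rfl, rfl⟩, h₂⟩ := h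
  obtain ⟨e, rfl⟩ := Prime.eq_of_toPQ_eq_add (q := .pre c a) (h₁.eq_of_prime hp).symm
  rw [add_zero] at h₂
  exact ⟨a, e, h₂⟩

theorem QWeak.eq_msg_of_prime {p : Prime N 0} (hp : ∀ n x, p ≠ .amb n x) {n : Id N 0}
    {y : PQ N 0} (h : QWeak (QMsgStep n) p.toPQ y) : p = .msg n := by
  obtain ⟨_, b, h₁, rfl, h₂⟩ := h
  exact (Prime.eq_of_toPQ_eq_add (q := .msg n) (h₁.eq_of_prime hp).symm).1

theorem QBisim.exists_prime {p : Prime N 0} {y : PQ N 0} (h : QBisim p.toPQ y) :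
    ∃ q : Prime N 0, y = q.toPQ := by
  have h0 : y ≠ 0 := by
    rintro rfl
    exact PQ.prime_ne_zero p (isCore_qBisim.zero (isCore_qBisim.symm h))
  obtain ⟨q, z, rfl⟩ := PQ.exists_prime_add h0
  obtain ⟨x₁, x₂, e, h₁, h₂⟩ := isCore_qBisim.add (isCore_qBisim.symm h)
  refine ⟨q, ?_⟩
  rcases PQ.prime_eq_add e with ⟨rfl, -⟩ | ⟨-, rfl⟩
  · exact absurd (isCore_qBisim.zero (isCore_qBisim.symm h₁)) (PQ.prime_ne_zero q)
  · rw [isCore_qBisim.zero (isCore_qBisim.symm h₂), add_zero]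

theorem QBisim.exists_guard {p : Prime N 0} (hp : ∀ n x, p ≠ .amb n x) {y : PQ N 0}
    (h : QBisim p.toPQ y) : ∃ q : Prime N 0, y = q.toPQ ∧ ∀ n x, q ≠ .amb n x := by
  obtain ⟨q, rfl⟩ := h.exists_prime
  refine ⟨q, rfl, ?_⟩
  rintro n x rfl
  obtain ⟨z, e, -⟩ := isCore_qBisim.amb (isCore_qBisim.symm h)
  exact hp n z (Prime.toPQ_injective (a₂ := .amb n z) e)

theorem QBisim.exists_pre {c : Cap (Id N 0)} {x y : PQ N 0} (h : QBisim (PQ.pre c x) y) :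
    ∃ y', y = PQ.pre c y' ∧ (∃ x'', QEvolve c x x'' ∧ QBisim x'' y') ∧
      ∃ y'', QEvolve c y' y'' ∧ QBisim y'' x := by
  have symm : ∀ {x y : PQ N 0}, QBisim x y → QBisim y x := isCore_qBisim.symm
  obtain ⟨q, rfl, hq⟩ := QBisim.exists_guard (p := .pre c x) (by simp) h
  obtain ⟨a, y'', h₁, h₂, h₃⟩ := isCore_qBisim.cap h
  obtain ⟨y, rfl, hy⟩ := h₁.eq_pre_of_prime hq
  obtain ⟨b, x'', h₁', h₂', h₃'⟩ := isCore_qBisim.cap (symm h)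
  obtain ⟨x', e, hx⟩ := QWeak.eq_pre_of_prime (p := .pre c x) (by simp) h₁'
  cases e
  exact ⟨y, rfl, ⟨x'', h₂'.head hx, symm h₃'⟩, y'', h₂.head hy, symm h₃⟩

theorem QBisim.eq_msg {n : Id N 0} {y : PQ N 0} (h : QBisim (PQ.msg n) y) : y = PQ.msg n := by
  obtain ⟨q, rfl, hq⟩ := QBisim.exists_guard (p := .msg n) (by simp) h
  obtain ⟨y', h₁, -⟩ := isCore_qBisim.msg h
  rw [h₁.eq_msg_of_prime hq]
  rfl

theorem QBisim.exists_abs {x : PQ N 1} {y : PQ N 0} (h : QBisim (PQ.abs x) y) :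
    ∃ y', y = PQ.abs y' := by
  have h' := isCore_qBisim.symm h
  obtain ⟨q, rfl, hq⟩ := QBisim.exists_guard (p := .abs x) (by simp) h
  cases q with
  | amb n z => exact absurd rfl (hq n z)
  | pre c z =>
    obtain ⟨a, y', h₁, -⟩ := isCore_qBisim.cap h'
    obtain ⟨_, e, -⟩ := QWeak.eq_pre_of_prime (p := .abs x) (by simp) h₁
    cases e
  | msg n =>
    obtain ⟨y', h₁, -⟩ := isCore_qBisim.msg h'
    cases QWeak.eq_msg_of_prime (p := .abs x) (by simp) h₁
  | abs y => exact ⟨y, rfl⟩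

/-! ### Bisimilarity of replicated processes -/

/-- Since `!x` does not change when one of its prime components is removed, a prime component can be
removed from a process bisimilar to `!x`. -/
theorem QBisim.repl_cancel_prime {q : Prime N 0} {z x : PQ N 0}
    (h : QBisim (q.toPQ + z) (PQ.repl x)) : QBisim z (PQ.repl x) := by
  obtain ⟨u, v, e, hu, hv⟩ := isCore_qBisim.add h
  obtain ⟨p, rfl⟩ := hu.exists_prime
  rwa [(PQ.repl_eq_prime_add e).1] at hv

/-- A prime component `q` of a process bisimilar to `!x` can be completed to a process bisimilar to
`x` with the help of components of any `!z` which is bisimilar to `!x`. -/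
theorem QBisim.exists_completion {q : Prime N 0} {w x z : PQ N 0}
    (h : QBisim (q.toPQ + w) (PQ.repl x)) (hz : QBisim (PQ.repl z) (PQ.repl x)) :
    ∃ t, QBisim x (q.toPQ + t) ∧ PQ.repl z + PQ.repl t = PQ.repl z := by
  obtain ⟨u, v, e, hu, -⟩ := isCore_qBisim.add h
  obtain ⟨p, rfl⟩ := hu.exists_prime
  obtain ⟨y, rfl⟩ := (PQ.repl_eq_prime_add e).2
  have e' : PQ.repl (p.toPQ + y) = y + (PQ.repl (p.toPQ + y) + p.toPQ) := by
    conv_lhs => rw [← PQ.repl_add_self]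
    abel
  have hz' := isCore_qBisim.symm hz
  rw [e'] at hz'
  obtain ⟨t, t', et, ht, -⟩ := isCore_qBisim.add hz'
  exact ⟨t, .add (isCore_qBisim.symm hu) ht, PQ.repl_absorb et⟩

theorem PQ.repl_add_of_repl_add_repl {x y : PQ N 0} (h : PQ.repl x + PQ.repl y = PQ.repl x) :
    PQ.repl x + y = PQ.repl x := by
  rw [← h, add_assoc, PQ.repl_add_self]

theorem QBisim.repl_cancel_primes {M : List (Prime N 0)} {z x : PQ N 0}
    (h : QBisim (z + (M.map Prime.toPQ).sum) (PQ.repl x)) : QBisim z (PQ.repl x) := by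
  induction M with
  | nil => simpa using h
  | cons q M ih =>
    rw [List.map_cons, List.sum_cons, add_left_comm] at h
    exact ih h.repl_cancel_prime

theorem QBisim.exists_list_of_primes {M : List (Prime N 0)} {z x : PQ N 0}
    (h : QBisim (PQ.repl z + (M.map Prime.toPQ).sum) (PQ.repl x)) :
    ∃ K : List (PQ N 0), (∀ k ∈ K, QBisim x k) ∧
      PQ.repl z + (M.map Prime.toPQ).sum = PQ.repl z + K.sum := by
  induction M with
  | nil => exact ⟨[], by simp, by simp⟩
  | cons q M ih =>
    rw [List.map_cons, List.sum_cons, add_left_comm] at h ⊢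
    obtain ⟨K, hK, e⟩ := ih h.repl_cancel_prime
    obtain ⟨t, ht, et⟩ := h.exists_completion h.repl_cancel_prime.repl_cancel_primes
    refine ⟨(q.toPQ + t) :: K, by simpa using ⟨ht, hK⟩, ?_⟩
    conv_lhs => rw [e, ← PQ.repl_add_of_repl_add_repl et]
    rw [List.sum_cons]
    abel

theorem QBisim.exists_list_of_repl_primes {L : List (Prime N 0)} {z x : PQ N 0}
    (h : QBisim (PQ.repl z) (PQ.repl x)) (hL : ∀ q ∈ L, ∃ w, PQ.repl z = q.toPQ + w) :
    ∃ (K : List (PQ N 0)) (t : PQ N 0), (∀ k ∈ K, QBisim x k) ∧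
      (K.map PQ.repl).sum = PQ.repl (L.map Prime.toPQ).sum + t ∧
      PQ.repl z + t = PQ.repl z := by
  induction L with
  | nil => exact ⟨[], 0, by simp, by simp [PQ.repl_zero], add_zero _⟩
  | cons q L ih =>
    obtain ⟨K, t, hK, e, ht⟩ := ih fun p hp => hL p (List.mem_cons_of_mem _ hp)
    obtain ⟨w, hw⟩ := hL q List.mem_cons_self
    have hq := h
    rw [hw] at hq
    obtain ⟨s, hs, es⟩ := hq.exists_completion h
    refine ⟨(q.toPQ + s) :: K, PQ.repl s + t, by simpa using ⟨hs, hK⟩, ?_, ?_⟩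
    · simp only [List.map_cons, List.sum_cons, PQ.repl_add, e]
      abel
    · rw [← add_assoc, es, ht]

theorem QBisim.exists_repl {x y : PQ N 0} (h : QBisim (PQ.repl x) y) :
    ∃ K₁ K₂ : List (PQ N 0), K₁ ≠ [] ∧ y = (K₁.map PQ.repl).sum + K₂.sum ∧
      (∀ k ∈ K₁, QBisim x k) ∧ ∀ k ∈ K₂, QBisim x k := by
  obtain ⟨L, M, rfl⟩ := PQ.exists_prime_lists y
  have h' := isCore_qBisim.symm h
  have hz := h'.repl_cancel_primes
  obtain ⟨K₂, h₂, e₂⟩ := h'.exists_list_of_primes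
  obtain ⟨K₁, t, h₁, e₁, ht⟩ := hz.exists_list_of_repl_primes (L := L) fun q hq => by
    obtain ⟨A, B, rfl⟩ := List.append_of_mem hq
    rw [← PQ.repl_add_self]
    simp only [List.map_append, List.map_cons, List.sum_append, List.sum_cons]
    rw [add_left_comm ((A.map Prime.toPQ).sum), add_left_comm]
    exact ⟨_, rfl⟩
  -- one more process bisimilar to `x` makes the first list nonempty
  have hx := isCore_qBisim.symm hz
  rw [← PQ.repl_add_self, add_comm] at hx
  obtain ⟨k, k', ek, hk, -⟩ := isCore_qBisim.add hx
  refine ⟨k :: K₁, K₂, by simp, ?_, by simpa using ⟨hk, h₁⟩, h₂⟩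
  rw [e₂, List.map_cons, List.sum_cons, e₁, ht, add_comm (PQ.repl k), PQ.repl_absorb ek]

theorem QBisim.repl_add_sum {x y : PQ N 0} (h : QBisim (PQ.repl x) y) {K : List (PQ N 0)}
    (hK : ∀ k ∈ K, QBisim x k) : QBisim (PQ.repl x) (y + K.sum) := by
  induction K with
  | nil => simpa using h
  | cons k K ih =>
    have := (ih fun j hj => hK j (List.mem_cons_of_mem _ hj)).add (hK k List.mem_cons_self)
    rwa [PQ.repl_add_self, add_assoc, add_comm K.sum, ← List.sum_cons] at this

theorem QBisim.repl_sum {x : PQ N 0} {K : List (PQ N 0)} (h : K ≠ []) (hK : ∀ k ∈ K, QBisim x k) :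
    QBisim (PQ.repl x) (K.map PQ.repl).sum := by
  induction K with
  | nil => exact absurd rfl h
  | cons k K ih =>
    have hk := (hK k List.mem_cons_self).repl
    rcases eq_or_ne K [] with rfl | hne
    · simpa using hk
    · have := hk.add (ih hne fun j hj => hK j (List.mem_cons_of_mem _ hj))
      rwa [PQ.repl_add_repl] at this

/-! ### Bisimilarity satisfies the clauses of the inductive relation -/

theorem PQ.mk_parList (L : List (Proc N 0)) : PQ.mk (Proc.parList L) = (L.map PQ.mk).sum := by
  induction L with
  | nil => rfl
  | cons P L ih => rw [List.map_cons, List.sum_cons, ← ih]; rfl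

theorem PQ.exists_map_mk (K : List (PQ N 0)) : ∃ L : List (Proc N 0), L.map PQ.mk = K := by
  choose f hf using PQ.exists_mk (N := N) (k := 0)
  exact ⟨K.map f, by rw [List.map_map, show PQ.mk ∘ f = id from funext hf, List.map_id]⟩

theorem indClause_of_intBisim [Infinite N] {P Q : Proc N 0} (h : IntBisim P Q) :
    IndClause IntBisim P Q := by
  rw [intBisim_iff_qBisim] at h
  cases P with
  | nil => exact PQ.mk_eq_mk.1 (isCore_qBisim.zero h)
  | amb n P =>
    rw [PQ.mk_amb] at h
    obtain ⟨y, e, h'⟩ := isCore_qBisim.amb h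
    obtain ⟨Q', rfl⟩ := PQ.exists_mk y
    exact ⟨Q', PQ.mk_eq_mk.1 e, intBisim_iff_qBisim.2 h'⟩
  | par P₁ P₂ =>
    rw [PQ.mk_par] at h
    obtain ⟨y₁, y₂, e, h₁, h₂⟩ := isCore_qBisim.add h
    obtain ⟨Q₁, rfl⟩ := PQ.exists_mk y₁
    obtain ⟨Q₂, rfl⟩ := PQ.exists_mk y₂
    exact ⟨Q₁, Q₂, PQ.mk_eq_mk.1 e, intBisim_iff_qBisim.2 h₁, intBisim_iff_qBisim.2 h₂⟩
  | repl P =>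
    rw [PQ.mk_repl] at h
    obtain ⟨K₁, K₂, hne, e, h₁, h₂⟩ := QBisim.exists_repl h
    obtain ⟨L₁, rfl⟩ := PQ.exists_map_mk K₁
    obtain ⟨L₂, rfl⟩ := PQ.exists_map_mk K₂
    refine ⟨L₁, L₂, by simpa using hne, PQ.mk_eq_mk.1 ?_,
      fun Q' hQ' => intBisim_iff_qBisim.2 (h₁ _ (List.mem_map_of_mem hQ')),
      fun Q' hQ' => intBisim_iff_qBisim.2 (h₂ _ (List.mem_map_of_mem hQ'))⟩
    rw [e, PQ.mk_par, PQ.mk_parList, PQ.mk_parList, List.map_map, List.map_map]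
    rfl
  | pre c P =>
    rw [PQ.mk_pre] at h
    obtain ⟨y, e, ⟨x'', h₁, h₂⟩, y'', h₃, h₄⟩ := QBisim.exists_pre h
    obtain ⟨Q', rfl⟩ := PQ.exists_mk y
    obtain ⟨P'', hP, rfl⟩ := (induces_evolve c).lift h₁
    obtain ⟨Q'', hQ, rfl⟩ := (induces_evolve c).lift h₃
    exact ⟨Q', PQ.mk_eq_mk.1 e, ⟨P'', hP, intBisim_iff_qBisim.2 h₂⟩,
      Q'', hQ, intBisim_iff_qBisim.2 h₄⟩
  | msg n => exact PQ.mk_eq_mk.1 (QBisim.eq_msg h)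
  | abs P =>
    rw [PQ.mk_abs] at h
    obtain ⟨y, e⟩ := QBisim.exists_abs h
    obtain ⟨Q', rfl⟩ := PQ.exists_mk y
    obtain ⟨m, hm⟩ : ∃ m, m ∉ P.fn ∪ Q.fn := by
      have := ((Proc.par (.abs P) Q).ids_finite.preimage
        (Sum.inl_injective (α := N) (β := Fin 0)).injOn).exists_notMem
      simpa [Proc.inl_mem_ids, Proc.fn] using this
    have h' := isCore_qBisim.symm h
    rw [e] at h'
    obtain ⟨z, h₁, h₂⟩ := isCore_qBisim.input h (.inl m)
    obtain ⟨w, h₃, h₄⟩ := isCore_qBisim.input h' (.inl m)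
    obtain ⟨Q'', hQ, rfl⟩ := induces_reds.lift (P := .par Q (.msg (.inl m))) h₁
    obtain ⟨P'', hP, rfl⟩ := induces_reds.lift (P := .par (.abs P) (.msg (.inl m))) h₃
    exact ⟨Q', m, hm, PQ.mk_eq_mk.1 e,
      ⟨Q'', hQ, intBisim_iff_qBisim.2 (isCore_qBisim.symm h₂)⟩,
      P'', hP, intBisim_iff_qBisim.2 (isCore_qBisim.symm h₄)⟩

theorem intBisim_of_indClause [Infinite N] {P Q : Proc N 0} (h : IndClause IntBisim P Q) :
    IntBisim P Q := by
  rw [intBisim_iff_qBisim]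
  cases P with
  | nil => rw [PQ.mk_eq_mk.2 h]; exact .refl _
  | amb n P =>
    obtain ⟨Q', hQ, h'⟩ := h
    rw [PQ.mk_eq_mk.2 hQ]
    exact .amb (intBisim_iff_qBisim.1 h')
  | par P₁ P₂ =>
    obtain ⟨Q₁, Q₂, hQ, h₁, h₂⟩ := h
    rw [PQ.mk_eq_mk.2 hQ]
    exact .add (intBisim_iff_qBisim.1 h₁) (intBisim_iff_qBisim.1 h₂)
  | repl P =>
    obtain ⟨L₁, L₂, hne, hQ, h₁, h₂⟩ := h
    have mem : ∀ {L : List (Proc N 0)}, (∀ Q' ∈ L, IntBisim P Q') →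
        ∀ k ∈ L.map PQ.mk, QBisim (PQ.mk P) k := by
      intro L hL k hk
      obtain ⟨Q', hQ', rfl⟩ := List.mem_map.1 hk
      exact intBisim_iff_qBisim.1 (hL Q' hQ')
    have := (QBisim.repl_sum (by simpa using hne) (mem h₁)).repl_add_sum (mem h₂)
    rw [PQ.mk_eq_mk.2 hQ, PQ.mk_par, PQ.mk_parList, PQ.mk_parList, List.map_map]
    rwa [List.map_map] at this
  | pre c P =>
    obtain ⟨Q', hQ, ⟨P'', hP, h₁⟩, Q'', hQ', h₂⟩ := h
    rw [PQ.mk_eq_mk.2 hQ]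
    exact .pre ((induces_evolve c).map hP) (intBisim_iff_qBisim.1 h₁)
      ((induces_evolve c).map hQ') (intBisim_iff_qBisim.1 h₂)
  | msg n => rw [PQ.mk_eq_mk.2 h]; exact .refl _
  | abs P =>
    obtain ⟨Q', m, hm, hQ, ⟨Q'', hQ', h₁⟩, P'', hP, h₂⟩ := h
    have hmQ : m ∉ (Proc.abs Q').fn := fun hm' =>
      hm (.inr (Proc.inl_mem_ids.1 (hQ.ids_eq ▸ Proc.inl_mem_ids.2 hm')))
    have hx := QBisim.exists_input (X := P) (fun h => hm (.inl h)) (fun h => hm (.inr h)) hQ'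
      (intBisim_iff_qBisim.1 h₁)
    have hy := QBisim.exists_input (X := Q') (Y := .abs P) hmQ (fun h => hm (.inl h)) hP
      (intBisim_iff_qBisim.1 h₂)
    rw [PQ.mk_eq_mk.2 hQ] at hx ⊢
    rw [PQ.mk_abs] at hx hy ⊢
    exact .abs hx hy

end MA

theorem mainTheorem3 {N : Type u} [Infinite N] :
    WellFounded (MA.ProcLT (N := N)) ∧
    MA.IsWellFoundedRecursion (MA.IndClause (N := N)) ∧
    ∃ simInd : MA.Proc N 0 → MA.Proc N 0 → Prop,
      (∀ P Q, simInd P Q ↔ MA.IndClause simInd P Q) ∧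
      (∀ R : MA.Proc N 0 → MA.Proc N 0 → Prop,
        (∀ P Q, R P Q ↔ MA.IndClause R P Q) → ∀ P Q, R P Q ↔ simInd P Q) ∧
      ∀ P Q, simInd P Q ↔ MA.IntBisim P Q := by
  have fixed : ∀ P Q : MA.Proc N 0, MA.IntBisim P Q ↔ MA.IndClause MA.IntBisim P Q :=
    fun _ _ => ⟨MA.indClause_of_intBisim, MA.intBisim_of_indClause⟩
  exact ⟨MA.wellFounded_procLT, MA.isWellFoundedRecursion_indClause, MA.IntBisim, fixed,
    fun R hR => MA.isWellFoundedRecursion_indClause.fixedPoint_unique hR fixed,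
    fun _ _ => Iff.rfl⟩
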